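/- Notation: $(a;q)_n=\prod_{k=0}^{n-1}(1-aq^k)$, $(a;q)_\infty=\prod_{k\ge 0}(1-aq^k)$ for $|q|<1$, $(q)_n=(q;q)_n$, with the convention $1/(q)_m=0$ for $m<0$; ${M\brack m}_q=\frac{(q)_M}{(q)_m(q)_{M-m}}$ if $m\ge 0$ and $M-m\ge 0$, and $0$ otherwise; $\left(\frac{j}{3}\right)$ is the Legendre symbol modulo $3$; and $$Q(q,z)=(q;q)_\infty(-z;q)_\infty(-q/z;q)_\infty\,(q/z^2;q^2)_\infty(z^2q;q^2)_\infty .$$ Let $v\ge 1$ be an integer. For integers $n_1,\dots,n_v\ge 0$ put $N_i=n_i+n_{i+1}+\cdots+n_v$ ($1\le i\le v$) and $$S_q(n_1,\dots,n_v)=\frac{q^{\sum_{i=1}^v N_i(N_i+1)+n_v}}{(q)_{n_1}\cdots(q)_{n_{v-1}}(q)_{2n_v+1}}\cdot\frac{(-1;q^3)_{n_v}}{(-1;q)_{n_v}}\,\bigl(1+q-q^{1+n_v}\bigr).$$ (i) (Finite version.) For every integer $L\ge 0$, $$\sum_{n_1,\dots,n_v\ge 0}S_q(n_1,\dots,n_v)\,\frac{(q)_{2L+1}}{(q)_{L-N_1}}=\sum_{j=-\infty}^{\infty}\left(\frac{j}{3}\right)q^{\frac{(2v+1)j^2-(2v+3)j}{2}+1}{2L+1\brack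 L+j}_q ,$$ where both sums have only finitely many nonzero terms. This holds for every element $q$ of a field of characteristic $0$ such that $q^k\neq 1$ for all $k\ge 1$ (in particular for $q$ an indeterminate). (ii) For every complex $q$ with $|q|<1$, the following series converges absolutely and $$\sum_{n_1,\dots,n_v\ge 0}S_q(n_1,\dots,n_v)=\frac{Q(q^{6v+3},-q^{2v})}{(q)_\infty}$$ (for $q=0$, $Q(q^{6v+3},-q^{2v})$ is read as its limit $1$ as $q\to 0$). -/

import Mathlib

namespace BaileyHierarchy

/-- The finite `q`-Pochhammer symbol `(a;q)_n = (1 - a)(1 - a q) ⋯ (1 - a q^(n-1))`. -/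
def qPoch {K : Type*} [Field K] (a q : K) (n : ℕ) : K :=
  ∏ k ∈ Finset.range n, (1 - a * q ^ k)

/-- The reciprocal `1 / (q;q)_m` for an integer `m`, equal to `0` for negative `m`. -/
def qqInv {K : Type*} [Field K] (q : K) (m : ℤ) : K :=
  if 0 ≤ m then 1 / qPoch q q m.toNat else 0

/-- The `q`-binomial coefficient with top entry `M` and bottom entry `m`, i.e.
`(q;q)_M / ((q;q)_m (q;q)_{M-m})` when `m ≥ 0` and `M - m ≥ 0`, and `0` otherwise. -/
def qBinom {K : Type*} [Field K] (q : K) (M m : ℤ) : K :=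
  if 0 ≤ m ∧ 0 ≤ M - m then
    qPoch q q M.toNat / (qPoch q q m.toNat * qPoch q q (M - m).toNat)
  else 0

/-- The infinite product `(a;q)_∞` over `ℂ` (convergent for `‖q‖ < 1`). -/
noncomputable def qPochInf (a q : ℂ) : ℂ := ∏' k : ℕ, (1 - a * q ^ k)

/-- The quintuple product
`Q(q,z) = (q, -z, -q/z; q)_∞ (q/z², z² q; q²)_∞` (for `‖q‖ < 1`, `z ≠ 0`). -/
noncomputable def Q (q z : ℂ) : ℂ :=
  qPochInf q q * qPochInf (-z) q * qPochInf (-(q / z)) q *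
    (qPochInf (q / z ^ 2) (q ^ 2) * qPochInf (z ^ 2 * q) (q ^ 2))

/-- `N_i = n_i + n_{i+1} + ⋯ + n_v`; the indices `1, …, v` are shifted to `0, …, v - 1`. -/
def N {v : ℕ} (n : Fin v → ℕ) (i : Fin v) : ℕ := ∑ j ∈ Finset.Ici i, n j

/-- The summand
`q^(∑ N_i (N_i + 1) + n_v) / ((q)_{n_1} ⋯ (q)_{n_{v-1}} (q)_{2 n_v + 1})
  * (-1;q^3)_{n_v} / (-1;q)_{n_v} * (1 + q - q^(1 + n_v))`.
The last index is `l = v - 1`, so `Finset.Iio l` stands for the indices `1, …, v - 1`. -/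
def summand {K : Type*} [Field K] {v : ℕ} (hv : 1 ≤ v) (q : K) (n : Fin v → ℕ) : K :=
  let l : Fin v := ⟨v - 1, by omega⟩
  q ^ ((∑ i, N n i * (N n i + 1)) + n l) /
      ((∏ i ∈ Finset.Iio l, qPoch q q (n i)) * qPoch q q (2 * n l + 1)) *
    (qPoch (-1) (q ^ 3) (n l) / qPoch (-1) q (n l)) *
    (1 + q - q ^ (1 + n l))

end BaileyHierarchy

namespace BaileyHierarchy

/-! ### Reciprocal Pochhammer symbols, q-Vandermonde summation and one step of the Bailey chain. -/

section Pochhammer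

variable {K : Type*} [Field K]

/-! The identity is a Bailey chain started from one explicit Bailey pair. Divided by `(q)_{2L+1}`,
the right-hand side becomes `thetaSum q v L`, whose exponent grows by `j(j-1)` when `v` grows by
one. The q-Vandermonde sum (`bailey_kernel`) shows that multiplying the `j`-th term by `q^(j(j-1))`
amounts to summing over `r ≤ L` against `q^(r(r+1)) / (q)_{L-r}` (`thetaSum_succ`). On the left, the
same operation adjoins a new first index with `N_1 = r` (`summand_cons`, `sum_shift`), so (i)
follows by induction from the closed form of `thetaSum q 0 L`.

That closed form is `base_pair`. With `w` a primitive cube root of unity, the Legendre symbol is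
`(w^j - w^(2j)) / (w - w^2)`. Each character sum is a finite q-binomial expansion; the factors `1 +
w q^i` and `1 + w q^(-i)` of its product combine into `w q^(-i) (1 - q^i + q^(2i))`, which explains
the quotient `(-1;q^3)_n / (-1;q)_n`. The unpaired factors produce `1 + q - q^(1+n)`.

For (ii), let `L → ∞` in (i) by dominated convergence. The theta series, grouped modulo 3, is the
quintuple product series in base `q^(6v+3)` at `-q^(2v)` (`tsum_theta_eq_quintuple`). The quintuple
product identity is itself the limit of a finite identity (`sum_quintTerm`) proved by telescoping.
-/

@[simp] theorem qPoch_zero (a q : K) : qPoch a q 0 = 1 := by simp [qPoch]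

theorem qPoch_succ (a q : K) (n : ℕ) : qPoch a q (n + 1) = qPoch a q n * (1 - a * q ^ n) := by
  simp [qPoch, Finset.prod_range_succ]

theorem qPoch_succ' (a q : K) (n : ℕ) : qPoch a q (n + 1) = (1 - a) * qPoch (a * q) q n := by
  simp [qPoch, Finset.prod_range_succ', pow_succ', mul_assoc, mul_comm]

theorem qPoch_add (a q : K) (m n : ℕ) :
    qPoch a q (m + n) = qPoch a q m * qPoch (a * q ^ m) q n := by
  simp [qPoch, Finset.prod_range_add, pow_add, mul_assoc]

theorem qPoch_self_ne_zero {q : K} (hq : ∀ k : ℕ, 1 ≤ k → q ^ k ≠ 1) (n : ℕ) :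
    qPoch q q n ≠ 0 := by
  refine Finset.prod_ne_zero_iff.2 fun k _ h => hq (k + 1) (by omega) ?_
  rw [pow_succ']
  exact (sub_eq_zero.1 h).symm

theorem qPoch_neg_one_ne_zero [CharZero K] {q : K} (hq : ∀ k : ℕ, 1 ≤ k → q ^ k ≠ 1) (n : ℕ) :
    qPoch (-1) q n ≠ 0 := by
  refine Finset.prod_ne_zero_iff.2 fun k _ h => ?_
  have h1 : q ^ k = -1 := by linear_combination h
  rcases Nat.eq_zero_or_pos k with rfl | hk
  · rw [pow_zero] at h1
    have h2 : (2 : K) = 0 := by linear_combination h1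
    exact two_ne_zero h2
  · refine hq (k * 2) (by omega) ?_
    rw [pow_mul, h1]
    norm_num

theorem qqInv_natCast (q : K) (n : ℕ) : qqInv q (n : ℤ) = 1 / qPoch q q n := by
  simp [qqInv]

theorem qqInv_of_neg (q : K) {m : ℤ} (hm : m < 0) : qqInv q m = 0 := by
  simp [qqInv, not_le.2 hm]

@[simp] theorem qqInv_zero (q : K) : qqInv q 0 = 1 := by simp [qqInv]

/-- This recurrence survives at `n = 0`, where both sides vanish. The convention `1/(q)_m = 0` for
`m < 0` thus absorbs the boundary terms in the recurrences below. -/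
theorem qqInv_sub_one {q : K} (hq : ∀ k : ℕ, 1 ≤ k → q ^ k ≠ 1) (n : ℕ) :
    qqInv q ((n : ℤ) - 1) = (1 - q ^ n) * qqInv q (n : ℤ) := by
  rcases n with _ | n
  · simp [qqInv]
  · rw [show ((n + 1 : ℕ) : ℤ) - 1 = (n : ℤ) by push_cast; ring, qqInv_natCast, qqInv_natCast]
    have h1 := qPoch_self_ne_zero hq n
    have h2 := qPoch_self_ne_zero hq (n + 1)
    rw [qPoch_succ] at h2 ⊢
    rw [← pow_succ'] at h2 ⊢
    have h3 := right_ne_zero_of_mul h2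
    field_simp

theorem qBinom_eq {q : K} (M m : ℤ) :
    qBinom q M m = qPoch q q M.toNat * (qqInv q m * qqInv q (M - m)) := by
  by_cases h1 : 0 ≤ m <;> by_cases h2 : 0 ≤ M - m <;> simp only [qBinom, qqInv, h1, h2] <;>
    simp [div_eq_mul_inv, mul_comm]

/-- The `q`-Pascal rule. -/
theorem qqInv_pascal {q : K} (hq : ∀ k : ℕ, 1 ≤ k → q ^ k ≠ 1) (M s : ℕ) (hs : s ≤ M + 1) :
    (1 - q ^ (M + 1)) * (qqInv q ((M : ℤ) + 1 - s) * qqInv q (s : ℤ)) =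
      q ^ s * (qqInv q ((M : ℤ) - s) * qqInv q (s : ℤ)) +
        qqInv q ((M : ℤ) + 1 - s) * qqInv q ((s : ℤ) - 1) := by
  obtain ⟨t, ht⟩ := Nat.exists_eq_add_of_le hs
  have h1 : (M : ℤ) + 1 - s = t := by omega
  have h2 : (M : ℤ) - s = (t : ℤ) - 1 := by omega
  rw [h1, h2, qqInv_sub_one hq, qqInv_sub_one hq, ht, pow_add]
  ring

/-- Split `1 - q^(M+1) = q^s (1 - q^(M+1-s)) + (1 - q^s)` and shift `s` by one in the second part.
The two pieces then recombine through `(1 - q^(s+m+1)) + q^(s+m+1) = 1`, trading a unit of `M` for a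
unit of `m`. -/
theorem qVandermonde_step {q : K} (hq : ∀ k : ℕ, 1 ≤ k → q ^ k ≠ 1) (M m : ℕ) :
    (1 - q ^ (M + 1)) * ∑ s ∈ Finset.range (M + 2),
      q ^ (s * (s + m)) * (qqInv q ((M : ℤ) + 1 - s) * qqInv q (s : ℤ)) * qqInv q ((s : ℤ) + m) =
    ∑ s ∈ Finset.range (M + 1),
      q ^ (s * (s + (m + 1))) * (qqInv q ((M : ℤ) - s) * qqInv q (s : ℤ)) *
        qqInv q ((s : ℤ) + m + 1) := by
  have key : ∀ s ∈ Finset.range (M + 2), (1 - q ^ (M + 1)) *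
      (q ^ (s * (s + m)) * (qqInv q ((M : ℤ) + 1 - s) * qqInv q (s : ℤ)) *
        qqInv q ((s : ℤ) + m)) =
      q ^ (s * (s + m)) * (q ^ s * (qqInv q ((M : ℤ) - s) * qqInv q (s : ℤ))) *
        qqInv q ((s : ℤ) + m) +
      q ^ (s * (s + m)) * (qqInv q ((M : ℤ) + 1 - s) * qqInv q ((s : ℤ) - 1)) *
        qqInv q ((s : ℤ) + m) := by
    intro s hs
    have := qqInv_pascal hq M s (by simp at hs; omega)
    linear_combination (q ^ (s * (s + m)) * qqInv q ((s : ℤ) + m)) * this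
  rw [Finset.mul_sum, Finset.sum_congr rfl key, Finset.sum_add_distrib, Finset.sum_range_succ,
    Finset.sum_range_succ' _ (M + 1)]
  rw [qqInv_of_neg q (show (M : ℤ) - (M + 1 : ℕ) < 0 by push_cast; omega),
    qqInv_of_neg q (show ((0 : ℕ) : ℤ) - 1 < 0 by omega)]
  simp only [zero_mul, mul_zero, add_zero]
  rw [← Finset.sum_add_distrib]
  refine Finset.sum_congr rfl fun s _ => ?_
  have h1 := qqInv_sub_one hq (s + m + 1)
  rw [show ((s + m + 1 : ℕ) : ℤ) - 1 = (s : ℤ) + m by push_cast; ring,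
    show ((s + m + 1 : ℕ) : ℤ) = (s : ℤ) + m + 1 by push_cast; ring] at h1
  rw [show (M : ℤ) + 1 - (s + 1 : ℕ) = M - s by push_cast; ring,
    show ((s + 1 : ℕ) : ℤ) - 1 = s by push_cast; ring,
    show ((s + 1 : ℕ) : ℤ) + m = (s : ℤ) + m + 1 by push_cast; ring, h1]
  ring

/-- The `q`-Chu–Vandermonde summation. -/
theorem qVandermonde {q : K} (hq : ∀ k : ℕ, 1 ≤ k → q ^ k ≠ 1) (M m : ℕ) :
    ∑ s ∈ Finset.range (M + 1),
      q ^ (s * (s + m)) * (qqInv q ((M : ℤ) - s) * qqInv q (s : ℤ)) * qqInv q ((s : ℤ) + m) =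
    qqInv q (M : ℤ) * qqInv q ((M : ℤ) + m) := by
  induction M generalizing m with
  | zero => simp
  | succ M ih =>
    have h := qVandermonde_step hq M m
    have h1 := ih (m + 1)
    push_cast at h1 ⊢
    simp only [← add_assoc] at h h1 ⊢
    rw [h1] at h
    have h2 := qqInv_sub_one hq (M + 1)
    push_cast at h2
    rw [add_sub_cancel_right] at h2
    rw [h2] at h
    have h3 : (1 : K) - q ^ (M + 1) ≠ 0 := fun h => hq (M + 1) (by omega) (by linear_combination -h)
    refine mul_left_cancel₀ h3 ?_
    rw [h, show (M : ℤ) + m + 1 = M + 1 + m by ring]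
    ring

/-- Terms with `r < a` vanish. Writing `r = a + s` and `L = a + M` gives `r(r+1) = a(a+1) +
s(s+2a+1)`, so the rest is q-Vandermonde with `m = 2a+1`. -/
theorem bailey_kernel_nat {q : K} (hq : ∀ k : ℕ, 1 ≤ k → q ^ k ≠ 1) (L a : ℕ) :
    ∑ r ∈ Finset.range (L + 1), q ^ (r * (r + 1)) * qqInv q ((L : ℤ) - r) *
      (qqInv q ((r : ℤ) + a + 1) * qqInv q ((r : ℤ) - a)) =
    q ^ (a * (a + 1)) * (qqInv q ((L : ℤ) + a + 1) * qqInv q ((L : ℤ) - a)) := by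
  rcases lt_or_ge L a with h | h
  · rw [qqInv_of_neg q (show (L : ℤ) - a < 0 by omega), mul_zero, mul_zero]
    refine Finset.sum_eq_zero fun r hr => ?_
    rw [qqInv_of_neg q (show (r : ℤ) - a < 0 by simp at hr; omega), mul_zero, mul_zero]
  · obtain ⟨M, rfl⟩ := Nat.exists_eq_add_of_le h
    rw [add_assoc, Finset.sum_range_add, Finset.sum_eq_zero, zero_add]
    · have h1 := qVandermonde hq M (2 * a + 1)
      rw [show ((a + M : ℕ) : ℤ) + a + 1 = M + (2 * a + 1 : ℕ) by push_cast; ring,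
        show ((a + M : ℕ) : ℤ) - a = M by push_cast; ring, mul_comm (qqInv q _), ← h1,
        Finset.mul_sum]
      refine Finset.sum_congr rfl fun s _ => ?_
      rw [show ((a + M : ℕ) : ℤ) - (a + s : ℕ) = M - s by push_cast; ring,
        show ((a + s : ℕ) : ℤ) + a + 1 = s + (2 * a + 1 : ℕ) by push_cast; ring,
        show ((a + s : ℕ) : ℤ) - a = s by push_cast; ring]
      ring
    · intro r hr
      rw [qqInv_of_neg q (show (r : ℤ) - a < 0 by simp at hr; omega), mul_zero, mul_zero]

/-- The Bailey lemma (with base point `a = q` and both parameters sent to infinity), for the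
unit Bailey pairs. -/
theorem bailey_kernel {q : K} (hq : ∀ k : ℕ, 1 ≤ k → q ^ k ≠ 1) (L : ℕ) (j : ℤ) :
    ∑ r ∈ Finset.range (L + 1), q ^ (r * (r + 1)) * qqInv q ((L : ℤ) - r) *
      (qqInv q ((r : ℤ) + j) * qqInv q ((r : ℤ) + 1 - j)) =
    q ^ (j * (j - 1)).toNat * (qqInv q ((L : ℤ) + j) * qqInv q ((L : ℤ) + 1 - j)) := by
  -- Both sides are invariant under `j ↦ 1 - j`, so `a = j - 1` or `a = -j` reduces to a natural
  -- number.
  rcases le_or_gt 1 j with h | h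
  · obtain ⟨a, ha⟩ := Int.eq_ofNat_of_zero_le (show 0 ≤ j - 1 by omega)
    obtain rfl : j = a + 1 := by omega
    have h1 := bailey_kernel_nat hq L a
    rw [show ((a : ℤ) + 1) * (a + 1 - 1) = ((a * (a + 1) : ℕ) : ℤ) by push_cast; ring,
      Int.toNat_natCast]
    simpa only [add_sub_add_right_eq_sub, add_assoc] using h1
  · obtain ⟨a, ha⟩ := Int.eq_ofNat_of_zero_le (show 0 ≤ -j by omega)
    obtain rfl : j = -a := by omega
    have h1 := bailey_kernel_nat hq L a
    rw [show (-(a : ℤ)) * (-a - 1) = ((a * (a + 1) : ℕ) : ℤ) by push_cast; ring,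
      Int.toNat_natCast]
    simp only [sub_neg_eq_add, ← sub_eq_add_neg]
    simp only [mul_comm (qqInv q ((_ : ℤ) - a)), add_right_comm _ (1 : ℤ) (a : ℤ)]
    exact h1

/-- The exponent `((2 w + 1) j ^ 2 - (2 w + 3) j) / 2 + 1`, as a natural number. -/
def expo (w : ℕ) (j : ℤ) : ℕ := ((j - 1) * (j - 2) / 2).toNat + w * (j * (j - 1)).toNat

theorem mul_pred_nonneg (j : ℤ) : 0 ≤ j * (j - 1) := by
  rcases le_or_gt 1 j with h | h
  · exact mul_nonneg (by omega) (by omega)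
  · exact mul_nonneg_of_nonpos_of_nonpos (by omega) (by omega)

theorem two_mul_expo (w : ℕ) (j : ℤ) :
    2 * (expo w j : ℤ) = (j - 1) * (j - 2) + 2 * w * (j * (j - 1)) := by
  have h1 := mul_pred_nonneg j
  have h2 : 0 ≤ (j - 1) * (j - 2) := by
    have := mul_pred_nonneg (j - 1)
    rwa [show j - 1 - 1 = j - 2 by ring] at this
  have h3 : 2 ∣ (j - 1) * (j - 2) := by
    have := Int.even_mul_pred_self (j - 1)
    rw [show j - 1 - 1 = j - 2 by ring] at this
    exact this.two_dvd
  have h4 := Int.mul_ediv_cancel' h3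
  have h5 : 0 ≤ (j - 1) * (j - 2) / 2 := Int.ediv_nonneg h2 (by norm_num)
  rw [expo]
  push_cast
  rw [Int.toNat_of_nonneg h1, Int.toNat_of_nonneg h5, mul_add, h4]
  ring

/-- The exponent is never negative, so the integer power is an ordinary power and `q = 0` needs no
separate treatment along the chain. -/
theorem expo_eq (w : ℕ) (j : ℤ) :
    ((2 * (w : ℤ) + 1) * j ^ 2 - (2 * (w : ℤ) + 3) * j) / 2 + 1 = (expo w j : ℤ) := by
  have h := two_mul_expo w j
  have h1 : (2 * (w : ℤ) + 1) * j ^ 2 - (2 * (w : ℤ) + 3) * j = 2 * ((expo w j : ℤ) - 1) := by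
    rw [mul_sub, h]
    ring
  rw [h1, Int.mul_ediv_cancel_left _ (by norm_num)]
  ring

theorem expo_succ (w : ℕ) (j : ℤ) : expo (w + 1) j = expo w j + (j * (j - 1)).toNat := by
  simp only [expo]
  ring

/-- The theta-type sum on the right-hand side, divided by `(q;q)_{2 L + 1}`. -/
noncomputable def thetaSum (q : K) (w L : ℕ) : K :=
  ∑ j ∈ Finset.Icc (-(L : ℤ)) (L + 1), ((legendreSym 3 j : ℤ) : K) * q ^ expo w j *
    (qqInv q ((L : ℤ) + j) * qqInv q ((L : ℤ) + 1 - j))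

theorem thetaSum_eq_sum (q : K) (w : ℕ) {r L : ℕ} (h : r ≤ L) :
    thetaSum q w r = ∑ j ∈ Finset.Icc (-(L : ℤ)) (L + 1), ((legendreSym 3 j : ℤ) : K) *
      q ^ expo w j * (qqInv q ((r : ℤ) + j) * qqInv q ((r : ℤ) + 1 - j)) := by
  refine Finset.sum_subset (Finset.Icc_subset_Icc (by omega) (by omega)) fun j _ hj => ?_
  rw [Finset.mem_Icc, not_and_or, not_le, not_le] at hj
  rcases hj with hj | hj
  · rw [qqInv_of_neg q (show (r : ℤ) + j < 0 by omega), zero_mul, mul_zero]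
  · rw [qqInv_of_neg q (show (r : ℤ) + 1 - j < 0 by omega), mul_zero, mul_zero]

/-- One step of the Bailey chain: exchange the sums over `r` and `j`, and apply `bailey_kernel` for
each `j`. -/
theorem thetaSum_succ {q : K} (hq : ∀ k : ℕ, 1 ≤ k → q ^ k ≠ 1) (w L : ℕ) :
    thetaSum q (w + 1) L =
      ∑ r ∈ Finset.range (L + 1), q ^ (r * (r + 1)) * qqInv q ((L : ℤ) - r) * thetaSum q w r := by
  have h : ∀ r ∈ Finset.range (L + 1),
      q ^ (r * (r + 1)) * qqInv q ((L : ℤ) - r) * thetaSum q w r =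
      ∑ j ∈ Finset.Icc (-(L : ℤ)) (L + 1), ((legendreSym 3 j : ℤ) : K) * q ^ expo w j *
        (q ^ (r * (r + 1)) * qqInv q ((L : ℤ) - r) *
          (qqInv q ((r : ℤ) + j) * qqInv q ((r : ℤ) + 1 - j))) := by
    intro r hr
    rw [thetaSum_eq_sum q w (show r ≤ L by simp at hr; omega), Finset.mul_sum]
    refine Finset.sum_congr rfl fun j _ => ?_
    ring
  rw [Finset.sum_congr rfl h, Finset.sum_comm, thetaSum]
  refine Finset.sum_congr rfl fun j _ => ?_
  rw [← Finset.mul_sum, bailey_kernel hq, expo_succ, pow_add]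
  ring

end Pochhammer


/-! ### The initial Bailey pair, via cube roots of unity. -/

section BasePair

variable {K : Type*} [Field K]

/-- The finite `q`-binomial theorem. -/
theorem qBinomial_theorem {q : K} (hq : ∀ k : ℕ, 1 ≤ k → q ^ k ≠ 1) (n : ℕ) (x : K) :
    ∑ k ∈ Finset.range (n + 1),
      q ^ k.choose 2 * x ^ k * (qqInv q ((n : ℤ) - k) * qqInv q (k : ℤ)) =
    qqInv q (n : ℤ) * qPoch (-x) q n := by
  induction n generalizing x with
  | zero => simp
  | succ n ih =>
    have h3 : (1 : K) - q ^ (n + 1) ≠ 0 := fun h => hq (n + 1) (by omega) (by linear_combination -h)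
    refine mul_left_cancel₀ h3 ?_
    have h2 := qqInv_sub_one hq (n + 1)
    push_cast at h2
    rw [add_sub_cancel_right] at h2
    have h4 := ih (x * q)
    push_cast
    have key : ∀ k ∈ Finset.range (n + 2), (1 - q ^ (n + 1)) *
        (q ^ k.choose 2 * x ^ k * (qqInv q ((n : ℤ) + 1 - k) * qqInv q (k : ℤ))) =
        q ^ k.choose 2 * x ^ k * (q ^ k * (qqInv q ((n : ℤ) - k) * qqInv q (k : ℤ))) +
        q ^ k.choose 2 * x ^ k * (qqInv q ((n : ℤ) + 1 - k) * qqInv q ((k : ℤ) - 1)) := by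
      intro k hk
      have := qqInv_pascal hq n k (by simp at hk; omega)
      linear_combination (q ^ k.choose 2 * x ^ k) * this
    rw [Finset.mul_sum, Finset.sum_congr rfl key, Finset.sum_add_distrib, Finset.sum_range_succ,
      Finset.sum_range_succ' _ (n + 1),
      qqInv_of_neg q (show (n : ℤ) - (n + 1 : ℕ) < 0 by push_cast; omega),
      qqInv_of_neg q (show ((0 : ℕ) : ℤ) - 1 < 0 by omega)]
    simp only [zero_mul, mul_zero, add_zero]
    rw [← Finset.sum_add_distrib, ← mul_assoc, ← h2, qPoch_succ']
    rw [show qqInv q (n : ℤ) * ((1 - -x) * qPoch (-x * q) q n) =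
      (1 + x) * (qqInv q (n : ℤ) * qPoch (-(x * q)) q n) by rw [neg_mul]; ring, ← h4,
      Finset.mul_sum]
    refine Finset.sum_congr rfl fun k _ => ?_
    rw [show (n : ℤ) + 1 - (k + 1 : ℕ) = n - k by push_cast; ring,
      show ((k + 1 : ℕ) : ℤ) - 1 = k by push_cast; ring, Nat.choose_succ_succ, Nat.choose_one_right]
    ring

theorem choose_two_cast (k : ℕ) : 2 * (k.choose 2 : ℤ) = k * (k - 1) := by
  induction k with
  | zero => simp
  | succ k ih =>
    rw [Nat.choose_succ_succ, Nat.choose_one_right]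
    push_cast
    linear_combination ih

/-- After the substitution `j = k - L` the exponent is `k.choose 2` up to a linear term and a
constant. This turns the twisted theta sum into a q-binomial sum with argument `w / q^(L+1)`. -/
theorem expo_zero_shift (L k : ℕ) :
    expo 0 ((k : ℤ) - L) + (L + 1) * k = k.choose 2 + (L + 2).choose 2 := by
  have h1 := two_mul_expo 0 ((k : ℤ) - L)
  have h2 := choose_two_cast k
  have h3 := choose_two_cast (L + 2)
  have : 2 * ((expo 0 ((k : ℤ) - L) : ℤ) + (L + 1) * k) =
      2 * ((k.choose 2 : ℤ) + ((L + 2).choose 2 : ℤ)) := by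
    push_cast at h1 h3
    linear_combination h1 - h2 - h3
  have := mul_left_cancel₀ two_ne_zero this
  exact_mod_cast this

/-- The theta sum twisted by a multiplicative character `j ↦ w ^ j`. -/
theorem twisted_sum {q : K} (hq : ∀ k : ℕ, 1 ≤ k → q ^ k ≠ 1) (hq0 : q ≠ 0) {w : K} (hw : w ≠ 0)
    (L : ℕ) :
    w ^ L * ∑ j ∈ Finset.Icc (-(L : ℤ)) (L + 1), w ^ j * q ^ expo 0 j *
      (qqInv q ((L : ℤ) + j) * qqInv q ((L : ℤ) + 1 - j)) =
    qqInv q ((2 * L + 1 : ℕ) : ℤ) *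
      (q ^ (L + 2).choose 2 * qPoch (-(w / q ^ (L + 1))) q (2 * L + 1)) := by
  rw [mul_left_comm, ← qBinomial_theorem hq, Finset.mul_sum, Finset.mul_sum]
  symm
  refine Finset.sum_bij (fun k _ => (k : ℤ) - L) ?_ ?_ ?_ ?_
  · intro k hk
    simp at hk ⊢
    omega
  · intro a _ b _ h
    simpa using h
  · intro j hj
    rw [Finset.mem_Icc] at hj
    exact ⟨(j + L).toNat, by simp; omega, by simp; omega⟩
  · intro k _
    have h1 : q ^ expo 0 ((k : ℤ) - L) * (q ^ (L + 1)) ^ k =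
        q ^ k.choose 2 * q ^ (L + 2).choose 2 := by
      rw [← pow_mul, ← pow_add, ← pow_add, expo_zero_shift]
    have h2 : w ^ L * w ^ ((k : ℤ) - L) = w ^ k := by
      rw [← zpow_natCast, ← zpow_add₀ hw, add_sub_cancel, zpow_natCast]
    rw [show ((2 * L + 1 : ℕ) : ℤ) - k = L + 1 - (k - L) by push_cast; ring,
      add_sub_cancel, div_pow]
    have h3 : (q ^ (L + 1)) ^ k ≠ 0 := by positivity
    field_simp
    linear_combination (-(qqInv q ((L : ℤ) + 1 - (k - L)) * qqInv q (k : ℤ))) *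
      (w ^ k * h1 + q ^ expo 0 ((k : ℤ) - L) * (q ^ (L + 1)) ^ k * h2)

/-- The product runs over `1 + w q^i` for `-(L+1) ≤ i ≤ L-1`. Opposite exponents pair up, and the
exponents `-L` and `-(L+1)` remain as the two linear factors. In the induction each step adds one
factor at either end. -/
theorem cubic_prod {q : K} (hq0 : q ≠ 0) {w : K} (hw : w ^ 2 + w + 1 = 0) (L : ℕ) :
    q ^ (L + 2).choose 2 * qPoch (-(w / q ^ (L + 1))) q (2 * L + 1) =
      -w ^ (L + 1) * (q ^ L + w) * (q ^ (L + 1) + w) *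
        ∏ i ∈ Finset.range L, (1 - q ^ i + q ^ (2 * i)) := by
  induction L with
  | zero =>
    simp [qPoch]
    field_simp
    linear_combination (q + w) * hw
  | succ L ih =>
    rw [show 2 * (L + 1) + 1 = (2 * L + 1) + 1 + 1 by ring, qPoch_succ, qPoch_succ',
      Finset.prod_range_succ, Nat.choose_succ_succ, Nat.choose_one_right,
      show -(w / q ^ (L + 1 + 1)) * q = -(w / q ^ (L + 1)) by
        field_simp
        ring]
    have h1 : q ^ (L + 2) * (1 - -(w / q ^ (L + 1 + 1))) = q ^ (L + 2) + w := by
      field_simp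
      ring
    have h2 : -(w / q ^ (L + 1 + 1)) * q ^ (2 * L + 1 + 1) = - (w * q ^ L) := by
      field_simp
      ring
    rw [h2, pow_add]
    have h3 : w * (1 - q ^ L + q ^ (2 * L)) = (1 + w * q ^ L) * (q ^ L + w) := by
      rw [two_mul, pow_add]
      linear_combination -(q ^ L) * hw
    calc _ = (q ^ (L + 2) * (1 - -(w / q ^ (L + 1 + 1)))) * (1 + w * q ^ L) *
          (q ^ (L + 2).choose 2 * qPoch (-(w / q ^ (L + 1))) q (2 * L + 1)) := by ring
      _ = _ := by
        rw [h1, ih]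
        linear_combination (w ^ (L + 1) * (q ^ (L + 1) + w) * (q ^ (L + 2) + w) *
          ∏ i ∈ Finset.range L, (1 - q ^ i + q ^ (2 * i))) * h3

theorem legendreSym_three_mul {w : K} (hw : w ^ 2 + w + 1 = 0) (j : ℤ) :
    ((legendreSym 3 j : ℤ) : K) * (w - w ^ 2) = w ^ j - (w ^ 2) ^ j := by
  have hw0 : w ≠ 0 := by
    rintro rfl
    simp at hw
  have h3 : w ^ 3 = 1 := by linear_combination (w - 1) * hw
  have h3' : (w ^ 2) ^ 3 = 1 := by rw [← pow_mul, mul_comm, pow_mul, h3, one_pow]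
  have red : ∀ z : K, z ≠ 0 → z ^ 3 = 1 → z ^ j = z ^ (j % 3) := by
    intro z hz hz3
    conv_lhs => rw [← Int.emod_add_mul_ediv j 3, zpow_add₀ hz, zpow_mul]
    rw [show z ^ (3 : ℤ) = 1 by exact_mod_cast hz3, one_zpow, mul_one]
  rw [red w hw0 h3, red (w ^ 2) (pow_ne_zero 2 hw0) h3', legendreSym.mod]
  have h0 : 0 ≤ j % 3 := Int.emod_nonneg _ (by norm_num)
  have h1 : j % 3 < 3 := Int.emod_lt_of_pos _ (by norm_num)
  have e0 : legendreSym 3 0 = 0 := by decide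
  have e1 : legendreSym 3 1 = 1 := by decide
  have e2 : legendreSym 3 2 = -1 := by decide
  push_cast
  generalize j % 3 = r at *
  interval_cases r
  · simp [e0]
  · simp [e1]
  · have a1 : w ^ (2 : ℤ) = w ^ 2 := by norm_cast
    have a2 : (w ^ 2) ^ (2 : ℤ) = w := by
      have : (w ^ 2) ^ (2 : ℤ) = (w ^ 2) ^ 2 := by norm_cast
      rw [this]
      linear_combination w * h3
    rw [e2, a1, a2]
    push_cast
    ring

theorem qPoch_neg_one_cube (q : K) (L : ℕ) :
    qPoch (-1) (q ^ 3) L =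
      qPoch (-1) q L * ∏ i ∈ Finset.range L, (1 - q ^ i + q ^ (2 * i)) := by
  rw [qPoch, qPoch, ← Finset.prod_mul_distrib]
  refine Finset.prod_congr rfl fun i _ => ?_
  ring

theorem base_pair_of_root {q : K} (hq : ∀ k : ℕ, 1 ≤ k → q ^ k ≠ 1) (hq0 : q ≠ 0) {w : K}
    (hw : w ^ 2 + w + 1 = 0) (hw' : w - w ^ 2 ≠ 0) (L : ℕ) :
    thetaSum q 0 L = q ^ L * (∏ i ∈ Finset.range L, (1 - q ^ i + q ^ (2 * i))) *
      qqInv q ((2 * L + 1 : ℕ) : ℤ) * (1 + q - q ^ (1 + L)) := by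
  have hw0 : w ≠ 0 := by
    rintro rfl
    simp at hw
  have main : ∀ z : K, z ^ 2 + z + 1 = 0 → z ≠ 0 →
      ∑ j ∈ Finset.Icc (-(L : ℤ)) (L + 1), z ^ j * q ^ expo 0 j *
        (qqInv q ((L : ℤ) + j) * qqInv q ((L : ℤ) + 1 - j)) =
      qqInv q ((2 * L + 1 : ℕ) : ℤ) * (-z * (q ^ L + z) * (q ^ (L + 1) + z) *
        ∏ i ∈ Finset.range L, (1 - q ^ i + q ^ (2 * i))) := by
    intro z hz hz0
    refine mul_left_cancel₀ (pow_ne_zero L hz0) ?_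
    rw [twisted_sum hq hq0 hz0, cubic_prod hq0 hz]
    ring
  have hw2 : (w ^ 2) ^ 2 + w ^ 2 + 1 = 0 := by linear_combination (w ^ 2 - w + 1) * hw
  have h3 : w ^ 3 = 1 := by linear_combination (w - 1) * hw
  refine mul_right_cancel₀ hw' ?_
  have h1 : thetaSum q 0 L * (w - w ^ 2) =
      ∑ j ∈ Finset.Icc (-(L : ℤ)) (L + 1), w ^ j * q ^ expo 0 j *
        (qqInv q ((L : ℤ) + j) * qqInv q ((L : ℤ) + 1 - j)) -
      ∑ j ∈ Finset.Icc (-(L : ℤ)) (L + 1), (w ^ 2) ^ j * q ^ expo 0 j *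
        (qqInv q ((L : ℤ) + j) * qqInv q ((L : ℤ) + 1 - j)) := by
    rw [← Finset.sum_sub_distrib, thetaSum, Finset.sum_mul]
    refine Finset.sum_congr rfl fun j _ => ?_
    linear_combination (q ^ expo 0 j * (qqInv q ((L : ℤ) + j) * qqInv q ((L : ℤ) + 1 - j))) *
      legendreSym_three_mul hw j
  rw [h1, main w hw hw0, main (w ^ 2) hw2 (pow_ne_zero 2 hw0)]
  generalize ∏ i ∈ Finset.range L, (1 - q ^ i + q ^ (2 * i)) = R
  generalize qqInv q ((2 * L + 1 : ℕ) : ℤ) = U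
  rw [add_comm 1 L, pow_succ]
  generalize q ^ L = Y
  -- In `z (Y + z) (qY + z)` the cubic term is `z^3 = 1` for both roots and cancels in the
  -- difference; the linear and quadratic terms give multiples of `w - w^2`.
  linear_combination (U * R * (Y * (1 + q) * w + w ^ 3)) * h3

theorem map_qPoch {F : Type*} [Field F] (φ : K →+* F) (a q : K) (n : ℕ) :
    φ (qPoch a q n) = qPoch (φ a) (φ q) n := by
  simp [qPoch, map_prod]

theorem map_qqInv {F : Type*} [Field F] (φ : K →+* F) (q : K) (m : ℤ) :
    φ (qqInv q m) = qqInv (φ q) m := by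
  unfold qqInv
  split_ifs <;> simp [map_qPoch]

theorem map_thetaSum {F : Type*} [Field F] (φ : K →+* F) (q : K) (w L : ℕ) :
    φ (thetaSum q w L) = thetaSum (φ q) w L := by
  simp [thetaSum, map_sum, map_qqInv]

/-- The shifted q-binomial argument divides by powers of `q`, so `q = 0` is checked directly: only
`j = 1` and `j = 2` have exponent zero, and they cancel unless `L = 0`. -/
theorem base_pair_zero (L : ℕ) :
    thetaSum (0 : K) 0 L = 0 ^ L * (∏ i ∈ Finset.range L, (1 - (0 : K) ^ i + 0 ^ (2 * i))) *
      qqInv (0 : K) ((2 * L + 1 : ℕ) : ℤ) * (1 + 0 - 0 ^ (1 + L)) := by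
  have hu : ∀ n : ℕ, qqInv (0 : K) (n : ℤ) = 1 := fun n => by simp [qqInv_natCast, qPoch]
  -- The range for `L + 1` is used because the range for `L = 0` does not contain `2`.
  have hsub : ({1, 2} : Finset ℤ) ⊆ Finset.Icc (-((L + 1 : ℕ) : ℤ)) ((L + 1 : ℕ) + 1) := by
    intro j hj
    simp at hj ⊢
    omega
  have e1 : legendreSym 3 1 = 1 := by decide
  have e2 : legendreSym 3 2 = -1 := by decide
  rw [thetaSum_eq_sum 0 0 (Nat.le_succ L), ← Finset.sum_subset hsub, Finset.sum_pair (by norm_num),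
    hu, e1, e2]
  · have h1 : expo 0 1 = 0 := by decide
    have h2 : expo 0 2 = 0 := by decide
    rw [h1, h2, show (L : ℤ) + 1 = (L + 1 : ℕ) by push_cast; ring,
      show ((L + 1 : ℕ) : ℤ) - 1 = (L : ℕ) by push_cast; ring,
      show (L : ℤ) + 2 = (L + 2 : ℕ) by push_cast; ring, hu, hu, hu]
    rcases L with _ | L
    · simp [qqInv]
    · rw [show ((L + 1 + 1 : ℕ) : ℤ) - 2 = L by push_cast; ring, hu]
      simp
  · intro j _ hj
    have : expo 0 j ≠ 0 := by
      intro h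
      have h1 := two_mul_expo 0 j
      rw [h] at h1
      simp at h1 hj
      omega
    rw [zero_pow this]
    simp

theorem base_pair [CharZero K] {q : K} (hq : ∀ k : ℕ, 1 ≤ k → q ^ k ≠ 1) (L : ℕ) :
    thetaSum q 0 L = q ^ L * (qPoch (-1) (q ^ 3) L / qPoch (-1) q L) *
      qqInv q ((2 * L + 1 : ℕ) : ℤ) * (1 + q - q ^ (1 + L)) := by
  rw [qPoch_neg_one_cube, mul_div_cancel_left₀ _ (qPoch_neg_one_ne_zero hq L)]
  rcases eq_or_ne q 0 with rfl | hq0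
  · exact base_pair_zero L
  · let φ := algebraMap K (AlgebraicClosure K)
    have : CharZero (AlgebraicClosure K) := charZero_of_injective_algebraMap φ.injective
    obtain ⟨w, hw⟩ : ∃ w : AlgebraicClosure K, w ^ 2 + w + 1 = 0 := by
      obtain ⟨w, hw⟩ := IsAlgClosed.exists_root
        (Polynomial.X ^ 2 + Polynomial.X + 1 : Polynomial (AlgebraicClosure K))
        (by
          have : (Polynomial.X ^ 2 + Polynomial.X + 1 : Polynomial (AlgebraicClosure K)).degree =
            2 := by compute_degree!
          rw [this]
          norm_num)
      exact ⟨w, by simpa [Polynomial.IsRoot] using hw⟩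
    have hw' : w - w ^ 2 ≠ 0 := by
      intro h
      -- Adding `hw` and `h` gives `2w + 1 = 0`, while `4(w^2 + w + 1) - (2w + 1)^2 = 3`.
      have h3 : (3 : AlgebraicClosure K) = 0 := by
        linear_combination 4 * hw - (2 * w + 1) * (hw + h)
      exact three_ne_zero h3
    apply φ.injective
    have hφ : ∀ k : ℕ, 1 ≤ k → φ q ^ k ≠ 1 := by
      intro k hk h
      rw [← map_pow, ← map_one φ] at h
      exact hq k hk (φ.injective h)
    rw [map_thetaSum, base_pair_of_root hφ (by simpa using hq0) hw hw' L]
    simp [map_prod, map_qqInv]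

end BasePair


/-! ### Iterating the Bailey chain: the finite identity. -/

section MultiSum

theorem sum_piFinset_cons {M : Type*} [AddCommMonoid M] (v : ℕ) (s : Finset ℕ)
    (f : (Fin (v + 1) → ℕ) → M) :
    ∑ n ∈ Fintype.piFinset (fun _ : Fin (v + 1) => s), f n =
      ∑ a ∈ s, ∑ n ∈ Fintype.piFinset (fun _ : Fin v => s),
        f (Fin.cons a n : Fin (v + 1) → ℕ) := by
  rw [← Finset.sum_product']
  symm
  refine Finset.sum_bij' (fun p _ => (Fin.cons p.1 p.2 : Fin (v + 1) → ℕ))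
    (fun n _ => (n 0, Fin.tail n)) ?_ ?_ ?_ ?_ ?_
  · intro p hp
    rw [Finset.mem_product, Fintype.mem_piFinset] at hp
    rw [Fintype.mem_piFinset]
    exact Fin.cases hp.1 hp.2
  · intro n hn
    rw [Fintype.mem_piFinset] at hn
    rw [Finset.mem_product, Fintype.mem_piFinset]
    exact ⟨hn 0, fun i => hn i.succ⟩
  · intro p _
    simp
  · intro n _
    simp
  · intro p _
    rfl

theorem N_eq_sum_ite {v : ℕ} (n : Fin v → ℕ) (i : Fin v) :
    N n i = ∑ j, if i ≤ j then n j else 0 := by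
  rw [N, ← Finset.sum_filter]
  congr 1
  ext j
  simp

theorem N_cons_succ {v : ℕ} (a : ℕ) (n : Fin v → ℕ) (i : Fin v) :
    N (Fin.cons a n : Fin (v + 1) → ℕ) i.succ = N n i := by
  rw [N_eq_sum_ite, N_eq_sum_ite, Fin.sum_univ_succ]
  simp [Fin.succ_ne_zero]

theorem N_zero_eq_sum {v : ℕ} (hv : 1 ≤ v) (n : Fin v → ℕ) : N n ⟨0, hv⟩ = ∑ j, n j := by
  rw [N_eq_sum_ite]
  refine Finset.sum_congr rfl fun j _ => ?_
  rw [if_pos (Fin.mk_le_of_le_val (Nat.zero_le _))]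

theorem N_cons_zero {v : ℕ} (hv : 1 ≤ v) (a : ℕ) (n : Fin v → ℕ) :
    N (Fin.cons a n : Fin (v + 1) → ℕ) 0 = a + N n ⟨0, hv⟩ := by
  rw [N_zero_eq_sum hv, ← Fin.sum_cons]
  exact N_zero_eq_sum (Nat.le_add_left 1 v) _

variable {K : Type*} [Field K]

theorem summand_one (q : K) (n : Fin 1 → ℕ) :
    summand le_rfl q n = q ^ (n 0 * (n 0 + 1)) *
      (q ^ n 0 * (qPoch (-1) (q ^ 3) (n 0) / qPoch (-1) q (n 0)) *
        qqInv q ((2 * n 0 + 1 : ℕ) : ℤ) * (1 + q - q ^ (1 + n 0))) := by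
  have h : N n 0 = n 0 := by rw [N_eq_sum_ite]; simp
  have h' : Finset.Iio (0 : Fin 1) = ∅ := by decide
  simp only [summand, Fin.mk_zero', Nat.sub_self, Finset.univ_unique,
    Fin.default_eq_zero, Finset.sum_singleton, h, h', Finset.prod_empty, one_mul, qqInv_natCast,
    pow_add _ (n 0 * (n 0 + 1))]
  ring

theorem summand_cons {v : ℕ} (hv : 1 ≤ v) (hv' : 1 ≤ v + 1) (q : K) (a : ℕ) (n : Fin v → ℕ) :
    summand hv' q (Fin.cons a n : Fin (v + 1) → ℕ) =
      q ^ ((a + N n ⟨0, hv⟩) * (a + N n ⟨0, hv⟩ + 1)) * qqInv q (a : ℤ) * summand hv q n := by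
  have hl : (⟨v + 1 - 1, by omega⟩ : Fin (v + 1)) = Fin.succ ⟨v - 1, by omega⟩ := by
    ext
    simp
    omega
  have hprod : ∀ i : Fin v, ∏ j ∈ Finset.Iio i.succ,
      qPoch q q ((Fin.cons a n : Fin (v + 1) → ℕ) j) =
      qPoch q q a * ∏ j ∈ Finset.Iio i, qPoch q q (n j) := by
    intro i
    have h1 : ∀ {w : ℕ} (i : Fin w) (f : Fin w → K),
        ∏ j ∈ Finset.Iio i, f j = ∏ j, if j < i then f j else 1 := by
      intro w i f
      rw [← Finset.prod_filter]
      congr 1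
      ext j
      simp
    rw [h1, h1, Fin.prod_univ_succ]
    simp
  simp only [summand, hl, hprod, Fin.cons_succ, Fin.sum_univ_succ, N_cons_zero hv, N_cons_succ,
    qqInv_natCast]
  rw [add_assoc, pow_add]
  simp only [div_eq_mul_inv, mul_inv]
  ring

/-- The substitution `r = a + s` matches a new first index `a` with the chain variable `r`.
Out-of-range terms on either side vanish through a negative index. -/
theorem sum_shift (q : K) {L M : ℕ} (h : L ≤ M) (s : ℕ) :
    ∑ a ∈ Finset.range (M + 1), q ^ ((a + s) * (a + s + 1)) * qqInv q (a : ℤ) *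
      qqInv q ((L : ℤ) - (a + s : ℕ)) =
    ∑ r ∈ Finset.range (L + 1), q ^ (r * (r + 1)) * qqInv q ((L : ℤ) - r) *
      qqInv q ((r : ℤ) - s) := by
  have h1 : ∑ r ∈ Finset.range (s + (M + 1)), q ^ (r * (r + 1)) * qqInv q ((L : ℤ) - r) *
      qqInv q ((r : ℤ) - s) = ∑ r ∈ Finset.range (L + 1), q ^ (r * (r + 1)) *
      qqInv q ((L : ℤ) - r) * qqInv q ((r : ℤ) - s) := by
    symm
    refine Finset.sum_subset (Finset.range_subset_range.2 (by omega)) fun r _ hr => ?_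
    rw [qqInv_of_neg q (show (L : ℤ) - r < 0 by simp at hr; omega)]
    simp
  rw [← h1, Finset.sum_range_add _ s (M + 1),
    Finset.sum_eq_zero (s := Finset.range s), zero_add]
  · refine Finset.sum_congr rfl fun a _ => ?_
    rw [show ((s + a : ℕ) : ℤ) - s = a by push_cast; ring, add_comm s a]
    ring
  · intro r hr
    rw [qqInv_of_neg q (show (r : ℤ) - s < 0 by simp at hr; omega)]
    simp

/-- The finite multisum identity, divided by `(q;q)_{2 L + 1}`. -/
theorem multisum_eq_thetaSum [CharZero K] {q : K} (hq : ∀ k : ℕ, 1 ≤ k → q ^ k ≠ 1) (v : ℕ)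
    (hv : 1 ≤ v) {L M : ℕ} (h : L ≤ M) :
    ∑ n ∈ Fintype.piFinset (fun _ : Fin v => Finset.range (M + 1)),
      summand hv q n * qqInv q ((L : ℤ) - N n ⟨0, hv⟩) = thetaSum q v L := by
  -- The box size `M` stays fixed while `L` varies: the inductive step needs the identity for every
  -- `r ≤ L` over one common box.
  induction v, hv using Nat.le_induction generalizing L with
  | base =>
    have h1 : ∑ r ∈ Finset.range (L + 1), q ^ (r * (r + 1)) * qqInv q ((L : ℤ) - r) *
        thetaSum q 0 r = ∑ r ∈ Finset.range (M + 1), q ^ (r * (r + 1)) * qqInv q ((L : ℤ) - r) *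
        thetaSum q 0 r := by
      refine Finset.sum_subset (Finset.range_subset_range.2 (by omega)) fun r _ hr => ?_
      rw [qqInv_of_neg q (show (L : ℤ) - r < 0 by simp at hr; omega)]
      simp
    rw [thetaSum_succ hq 0, h1, sum_piFinset_cons]
    refine Finset.sum_congr rfl fun r _ => ?_
    rw [Fintype.piFinset_of_isEmpty, Finset.univ_unique, Finset.sum_singleton, summand_one,
      N_zero_eq_sum, base_pair hq]
    simp
    ring
  | succ v hv ih =>
    rw [sum_piFinset_cons, Finset.sum_comm, thetaSum_succ hq]
    have h1 : ∀ r ∈ Finset.range (L + 1), q ^ (r * (r + 1)) * qqInv q ((L : ℤ) - r) *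
        thetaSum q v r =
        ∑ n ∈ Fintype.piFinset (fun _ : Fin v => Finset.range (M + 1)),
          summand hv q n * (q ^ (r * (r + 1)) * qqInv q ((L : ℤ) - r) *
            qqInv q ((r : ℤ) - N n ⟨0, hv⟩)) := by
      intro r hr
      rw [← ih (show r ≤ M by simp at hr; omega), Finset.mul_sum]
      refine Finset.sum_congr rfl fun n _ => ?_
      ring
    rw [(Finset.sum_congr rfl h1 :)]
    conv_rhs => rw [Finset.sum_comm]
    refine Finset.sum_congr rfl fun n _ => ?_
    rw [← Finset.mul_sum, ← sum_shift q h, Finset.mul_sum]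
    refine Finset.sum_congr rfl fun a _ => ?_
    rw [summand_cons hv, ← N_cons_zero hv]
    simp only [Fin.mk_zero']
    ring_nf

theorem le_N_zero {v : ℕ} (hv : 1 ≤ v) (n : Fin v → ℕ) (i : Fin v) : n i ≤ N n ⟨0, hv⟩ := by
  rw [N_zero_eq_sum]
  exact Finset.single_le_sum (f := n) (fun _ _ => Nat.zero_le _) (Finset.mem_univ i)

theorem mul_qqInv_eq_zero {v : ℕ} (hv : 1 ≤ v) (q c : K) (L : ℕ) (n : Fin v → ℕ)
    (hn : n ∉ Fintype.piFinset (fun _ : Fin v => Finset.range (L + 1))) :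
    c * qqInv q ((L : ℤ) - N n ⟨0, hv⟩) = 0 := by
  rw [Fintype.mem_piFinset, not_forall] at hn
  obtain ⟨i, hi⟩ := hn
  have h1 := le_N_zero hv n i
  rw [qqInv_of_neg q (by simp at hi; omega), mul_zero]

theorem finite_identity [CharZero K] {q : K} (hq : ∀ k : ℕ, 1 ≤ k → q ^ k ≠ 1) (v : ℕ)
    (hv : 1 ≤ v) (L : ℕ) :
    ∑ᶠ n : Fin v → ℕ, summand hv q n *
      (qPoch q q (2 * L + 1) * qqInv q ((L : ℤ) - (N n ⟨0, hv⟩ : ℤ))) =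
    ∑ᶠ j : ℤ, ((legendreSym 3 j : ℤ) : K) *
      q ^ (((2 * (v : ℤ) + 1) * j ^ 2 - (2 * (v : ℤ) + 3) * j) / 2 + 1) *
      qBinom q (2 * (L : ℤ) + 1) ((L : ℤ) + j) := by
  rw [finsum_eq_sum_of_support_subset (s := Fintype.piFinset fun _ => Finset.range (L + 1)),
    finsum_eq_sum_of_support_subset (s := Finset.Icc (-(L : ℤ)) (L + 1))]
  · have h1 : ∀ n ∈ Fintype.piFinset (fun _ : Fin v => Finset.range (L + 1)),
        summand hv q n * (qPoch q q (2 * L + 1) * qqInv q ((L : ℤ) - (N n ⟨0, hv⟩ : ℤ))) =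
        qPoch q q (2 * L + 1) * (summand hv q n * qqInv q ((L : ℤ) - (N n ⟨0, hv⟩ : ℤ))) :=
      fun n _ => mul_left_comm _ _ _
    rw [Finset.sum_congr rfl h1, ← Finset.mul_sum, multisum_eq_thetaSum hq v hv le_rfl, thetaSum,
      Finset.mul_sum]
    refine Finset.sum_congr rfl fun j _ => ?_
    rw [expo_eq, zpow_natCast, qBinom_eq, show 2 * (L : ℤ) + 1 = (2 * L + 1 : ℕ) by push_cast; ring,
      Int.toNat_natCast, show ((2 * L + 1 : ℕ) : ℤ) - (L + j) = L + 1 - j by push_cast; ring]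
    ring
  · intro j hj
    rw [Function.mem_support] at hj
    rw [Finset.mem_coe, Finset.mem_Icc]
    by_contra hc
    refine hj ?_
    rw [qBinom, if_neg (by omega), mul_zero]
  · intro n hn
    rw [Function.mem_support] at hn
    by_contra hc
    refine hn ?_
    rw [← mul_assoc]
    exact mul_qqInv_eq_zero hv q _ L n hc

end MultiSum


/-! ### A finite quintuple product identity and its symmetric form. -/

section FiniteQuintuple

variable {K : Type*} [Field K]

/-- The summand of the finite form of the quintuple product identity. -/
noncomputable def quintTerm (q x : K) (m k : ℕ) : K :=
  (1 + x * q ^ k) * (qPoch q q m * (qqInv q (k : ℤ) * qqInv q ((m : ℤ) - k))) *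
    (qPoch x q (m + 1) / qPoch (x ^ 2 * q ^ k) q (m + 1)) * (x ^ k * q ^ (k ^ 2))

/-- The telescoping certificate for `quintTerm`. -/
noncomputable def quintCert (q x : K) (m k : ℕ) : K :=
  -((qPoch q q m * (qqInv q ((k : ℤ) - 1) * qqInv q ((m : ℤ) + 1 - k))) *
    (qPoch x q (m + 1) / qPoch (x ^ 2 * q ^ k) q (m + 1)) *
      (x ^ k * q ^ (k * (k - 1) + m + 1)))

theorem quintTerm_telescope {q x : K} (hq : ∀ k : ℕ, 1 ≤ k → q ^ k ≠ 1)
    (hx : ∀ k : ℕ, x ^ 2 * q ^ k ≠ 1) {m k : ℕ} (hk : k ≤ m + 1) :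
    quintTerm q x (m + 1) k - quintTerm q x m k =
      quintCert q x m (k + 1) - quintCert q x m k := by
  obtain ⟨t, ht⟩ := Nat.exists_eq_add_of_le hk
  have h1 : ((m + 1 : ℕ) : ℤ) - k = t := by omega
  have h2 : (m : ℤ) - k = (t : ℤ) - 1 := by omega
  have h3 : (m : ℤ) + 1 - k = t := by omega
  have h4 : ((k + 1 : ℕ) : ℤ) - 1 = k := by omega
  have h5 : (m : ℤ) + 1 - (k + 1 : ℕ) = (t : ℤ) - 1 := by omega
  have e1 : q ^ (k * (k - 1) + m + 1) = q ^ (k ^ 2) * q ^ t := by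
    rw [← pow_add]
    congr 1
    rcases k with _ | k
    · omega
    · rw [Nat.add_sub_cancel, add_assoc, ht]
      ring
  have e2 : q ^ ((k + 1) * (k + 1 - 1) + m + 1) = q ^ (k ^ 2) * (q ^ t * (q ^ k) ^ 2) := by
    rw [← pow_mul, ← pow_add, ← pow_add, Nat.add_sub_cancel, add_assoc, ht]
    congr 1
    ring
  have em : q ^ (m + 1) = q ^ k * q ^ t := by rw [ht, pow_add]
  have d1 : qPoch (x ^ 2 * q ^ k) q (m + 1) =
      (1 - x ^ 2 * q ^ k) * qPoch (x ^ 2 * q ^ (k + 1)) q m := by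
    rw [qPoch_succ', pow_succ q k, mul_assoc _ (q ^ k)]
  have d2 : qPoch (x ^ 2 * q ^ (k + 1)) q (m + 1) =
      qPoch (x ^ 2 * q ^ (k + 1)) q m * (1 - x ^ 2 * (q ^ t * (q ^ k) ^ 2)) := by
    rw [qPoch_succ, mul_assoc (x ^ 2), ← pow_add, show k + 1 + m = k + (m + 1) by ring,
      pow_add q k (m + 1), em]
    ring
  have d3 : qPoch (x ^ 2 * q ^ k) q (m + 1 + 1) =
      (1 - x ^ 2 * q ^ k) * (qPoch (x ^ 2 * q ^ (k + 1)) q m *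
        (1 - x ^ 2 * (q ^ t * (q ^ k) ^ 2))) := by
    rw [qPoch_succ', ← d2, pow_succ q k, mul_assoc _ (q ^ k)]
  have n1 : 1 - x ^ 2 * q ^ k ≠ 0 := fun h => hx k (by linear_combination -h)
  have n2 : 1 - x ^ 2 * (q ^ t * (q ^ k) ^ 2) ≠ 0 := fun h => hx (t + 2 * k) (by
    rw [pow_add, mul_comm 2 k, pow_mul]
    linear_combination -h)
  have n3 : qPoch (x ^ 2 * q ^ (k + 1)) q m ≠ 0 := Finset.prod_ne_zero_iff.2 fun i _ h =>
    hx (k + 1 + i) (by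
      rw [pow_add]
      linear_combination -h)
  have p1 : qPoch q q (m + 1) = qPoch q q m * (1 - q ^ k * q ^ t) := by
    rw [qPoch_succ, ← pow_succ', em]
  have p2 : qPoch x q (m + 1 + 1) = qPoch x q (m + 1) * (1 - x * (q ^ k * q ^ t)) := by
    rw [qPoch_succ, em]
  simp only [quintTerm, quintCert, h1, h2, h3, h4, h5, e1, e2, d3, p1, p2, d2, d1,
    qqInv_sub_one hq, pow_succ x k]
  generalize qPoch (x ^ 2 * q ^ (k + 1)) q m = D at *
  generalize qPoch x q (m + 1) = X
  generalize qPoch q q m = R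
  generalize qqInv q (k : ℤ) = U
  generalize qqInv q (t : ℤ) = V
  generalize q ^ (k ^ 2) = W
  generalize x ^ k = Z
  generalize q ^ k = Y at *
  generalize q ^ t = A at *
  have n4 : 1 - x ^ 2 * A * Y ^ 2 ≠ 0 := by rwa [mul_assoc]
  have n5 : 1 - x ^ 2 * Y ^ 2 * A ≠ 0 := by rwa [mul_assoc, mul_comm (Y ^ 2)]
  field_simp
  ring

/-- A finite form of the quintuple product identity. -/
theorem sum_quintTerm {q x : K} (hq : ∀ k : ℕ, 1 ≤ k → q ^ k ≠ 1)
    (hx : ∀ k : ℕ, x ^ 2 * q ^ k ≠ 1) (m : ℕ) :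
    ∑ k ∈ Finset.range (m + 1), quintTerm q x m k = 1 := by
  induction m with
  | zero =>
    have h := hx 0
    have h1 : 1 - x ^ 2 ≠ 0 := fun h' => h (by linear_combination -h')
    simp [quintTerm, qPoch]
    field_simp
    ring
  | succ m ih =>
    -- The certificate vanishes at `k = 0` and at `k = m + 2`, each time through a factor
    -- `1/(q)_{-1}`; hence the sum does not depend on `m`.
    have h1 : ∑ k ∈ Finset.range (m + 2), (quintTerm q x (m + 1) k - quintTerm q x m k) = 0 := by
      rw [Finset.sum_congr rfl fun k hk => quintTerm_telescope hq hx
        (show k ≤ m + 1 by simp at hk; omega), Finset.sum_range_sub, quintCert, quintCert,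
        qqInv_of_neg q (show (m : ℤ) + 1 - (m + 2 : ℕ) < 0 by push_cast; omega),
        qqInv_of_neg q (show ((0 : ℕ) : ℤ) - 1 < 0 by omega)]
      simp
    rw [Finset.sum_sub_distrib, Finset.sum_range_succ (quintTerm q x m)] at h1
    have h2 : quintTerm q x m (m + 1) = 0 := by
      rw [quintTerm, qqInv_of_neg q (show (m : ℤ) - (m + 1 : ℕ) < 0 by push_cast; omega)]
      simp
    rw [h2, ih] at h1
    linear_combination h1

/-- Reverse the product, using `1 - x/q^i = -(x/q^i) (1 - q^i/x)` factor by factor. -/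
theorem qPoch_reflect {q x : K} (hq0 : q ≠ 0) (hx0 : x ≠ 0) (m : ℕ) :
    q ^ (m + 1).choose 2 * qPoch (x / q ^ m) q m = (-x) ^ m * qPoch (q / x) q m := by
  induction m with
  | zero => simp
  | succ m ih =>
    rw [qPoch_succ', qPoch_succ, Nat.choose_succ_succ, Nat.choose_one_right,
      show x / q ^ (m + 1) * q = x / q ^ m by
        field_simp
        ring, pow_add]
    have h1 : q ^ (m + 1) * (1 - x / q ^ (m + 1)) = -x * (1 - q / x * q ^ m) := by
      field_simp
      ring
    calc _ = (q ^ (m + 1) * (1 - x / q ^ (m + 1))) *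
          (q ^ (m + 1).choose 2 * qPoch (x / q ^ m) q m) := by ring
      _ = _ := by
        rw [h1, ih]
        ring

/-- The coefficient `(-1) ^ k x ^ (3 k) q ^ (k (3 k - 1) / 2)` of the quintuple product series. -/
noncomputable def quintCoeff (q x : K) (k : ℤ) : K :=
  (-1) ^ k * x ^ (3 * k) * q ^ (k * (3 * k - 1) / 2)

theorem quint_exponent (k : ℤ) : 2 * (k * (3 * k - 1) / 2) = k * (3 * k - 1) := by
  refine Int.mul_ediv_cancel' ?_
  rw [show k * (3 * k - 1) = k * (k - 1) + 2 * (k * k) by ring]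
  exact dvd_add (Int.even_mul_pred_self k).two_dvd (dvd_mul_right _ _)

theorem quintCoeff_shift {q x : K} (hq0 : q ≠ 0) (hx0 : x ≠ 0) {m κ t : ℕ} (h : κ + t = 2 * m) :
    (-x) ^ m * q ^ (t + 1).choose 2 * ((x / q ^ m) ^ κ * q ^ (κ ^ 2)) =
      quintCoeff q x ((κ : ℤ) - m) * ((-x ^ 2) ^ t * q ^ (m + 1).choose 2) := by
  have hs : (-1 : K) ^ m = (-1) ^ ((κ : ℤ) - m) * (-1) ^ t := by
    rw [← zpow_natCast, ← zpow_natCast, ← zpow_add₀ (by norm_num)]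
    congr 1
    omega
  have hxe : x ^ m * x ^ κ = x ^ (3 * ((κ : ℤ) - m)) * (x ^ 2) ^ t := by
    rw [← pow_mul, ← zpow_natCast, ← zpow_natCast, ← zpow_natCast, ← zpow_add₀ hx0,
      ← zpow_add₀ hx0]
    congr 1
    push_cast
    omega
  have hqe : q ^ (t + 1).choose 2 * q ^ (κ ^ 2) =
      q ^ (((κ : ℤ) - m) * (3 * ((κ : ℤ) - m) - 1) / 2) * q ^ (m + 1).choose 2 *
        (q ^ m) ^ κ := by
    rw [← pow_mul, ← zpow_natCast, ← zpow_natCast, ← zpow_natCast, ← zpow_natCast,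
      ← zpow_add₀ hq0, ← zpow_add₀ hq0, ← zpow_add₀ hq0]
    congr 1
    refine mul_left_cancel₀ (two_ne_zero (α := ℤ)) ?_
    have h1 := choose_two_cast (t + 1)
    have h2 := choose_two_cast (m + 1)
    have h3 := quint_exponent ((κ : ℤ) - m)
    have h4 : (t : ℤ) = 2 * m - κ := by omega
    push_cast at h1 h2 ⊢
    rw [h4] at h1
    linear_combination h1 - h2 - h3
  rw [quintCoeff, neg_pow x, neg_pow (x ^ 2), hs, div_pow]
  have hn : (q ^ m) ^ κ ≠ 0 := by positivity
  field_simp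
  linear_combination q ^ (t + 1).choose 2 * q ^ (κ ^ 2) * hxe +
    x ^ (3 * ((κ : ℤ) - m)) * (x ^ 2) ^ t * hqe

/-- The symmetric form of the summand of the finite quintuple product identity. -/
noncomputable def quintSymm (q x : K) (m : ℕ) (k : ℤ) : K :=
  quintCoeff q x k * (1 + x * q ^ k) *
    (qPoch q q (2 * m) * (qqInv q ((m : ℤ) + k) * qqInv q ((m : ℤ) - k)) *
      (qPoch (q / x) q m * qPoch x q (m + 1)) *
      ((qPoch (q / x ^ 2) q ((m : ℤ) - k).toNat)⁻¹ *
        (qPoch (x ^ 2) q ((m : ℤ) + k + 1).toNat)⁻¹))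

/-- Replacing `m` by `2m` and `x` by `x/q^m` centres the sum at `κ = m`. Both long Pochhammer
symbols split at the unshifted base point, and reflecting their lower parts leaves only factors that
converge as `m → ∞`. -/
theorem quintTerm_shift {q x : K} (hq0 : q ≠ 0) (hx0 : x ≠ 0)
    (hx : ∀ i : ℤ, x ^ 2 * q ^ i ≠ 1) {m κ : ℕ} (h : κ ≤ 2 * m) :
    quintTerm q (x / q ^ m) (2 * m) κ = quintSymm q x m ((κ : ℤ) - m) := by
  obtain ⟨t, ht⟩ := Nat.exists_eq_add_of_le h
  have a1 : (m : ℤ) + (κ - m) = κ := by ring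
  have a2 : (m : ℤ) - (κ - m) = t := by omega
  have a3 : ((2 * m : ℕ) : ℤ) - κ = t := by omega
  have hp : x * q ^ ((κ : ℤ) - m) = x / q ^ m * q ^ κ := by
    rw [zpow_sub₀ hq0, zpow_natCast, zpow_natCast]
    ring
  have b1 : qPoch (x / q ^ m) q (2 * m + 1) = qPoch (x / q ^ m) q m * qPoch x q (m + 1) := by
    rw [show 2 * m + 1 = m + (m + 1) by ring, qPoch_add, div_mul_cancel₀ _ (pow_ne_zero m hq0)]
  have b2 : (x / q ^ m) ^ 2 * q ^ κ = x ^ 2 / q ^ t := by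
    rw [div_pow, ← pow_mul, mul_comm m, ht, pow_add]
    field_simp
  have b3 : qPoch (x ^ 2 / q ^ t) q (2 * m + 1) =
      qPoch (x ^ 2 / q ^ t) q t * qPoch (x ^ 2) q (κ + 1) := by
    rw [show 2 * m + 1 = t + (κ + 1) by omega, qPoch_add, div_mul_cancel₀ _ (pow_ne_zero t hq0)]
  have c1 := qPoch_reflect hq0 hx0 m
  have c2 := qPoch_reflect hq0 (pow_ne_zero 2 hx0) t
  have c3 := quintCoeff_shift hq0 hx0 ht.symm
  have n1 : qPoch (x ^ 2) q (κ + 1) ≠ 0 := Finset.prod_ne_zero_iff.2 fun i _ h =>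
    hx i (by
      rw [zpow_natCast]
      linear_combination -h)
  have n2 : qPoch (q / x ^ 2) q t ≠ 0 := Finset.prod_ne_zero_iff.2 fun i _ h =>
    hx (-(i + 1 : ℕ)) (by
      have h1 : q / x ^ 2 * q ^ i = 1 := by linear_combination -h
      rw [zpow_neg, zpow_natCast, pow_succ]
      field_simp at h1 ⊢
      linear_combination -h1)
  have n3 : qPoch (x ^ 2 / q ^ t) q t ≠ 0 := by
    intro h0
    rw [h0, mul_zero] at c2
    exact mul_ne_zero (pow_ne_zero t (neg_ne_zero.2 (pow_ne_zero 2 hx0))) n2 c2.symm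
  rw [quintTerm, quintSymm, a1, a2, a3, b1, b2, b3, hp, Int.toNat_natCast,
    show ((κ : ℤ) + 1).toNat = κ + 1 by omega]
  have key : qPoch (x / q ^ m) q m / qPoch (x ^ 2 / q ^ t) q t * ((x / q ^ m) ^ κ * q ^ (κ ^ 2)) =
      quintCoeff q x ((κ : ℤ) - m) * (qPoch (q / x) q m * (qPoch (q / x ^ 2) q t)⁻¹) := by
    have hqm : q ^ (m + 1).choose 2 ≠ 0 := pow_ne_zero _ hq0
    have hqt : q ^ (t + 1).choose 2 ≠ 0 := pow_ne_zero _ hq0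
    have hxt : (-x ^ 2) ^ t ≠ 0 := pow_ne_zero t (neg_ne_zero.2 (pow_ne_zero 2 hx0))
    have c1' := eq_div_of_mul_eq hqm ((mul_comm _ _).trans c1)
    have c2' := eq_div_of_mul_eq hqt ((mul_comm _ _).trans c2)
    have c3' := eq_div_of_mul_eq (mul_ne_zero hxt hqm) c3.symm
    rw [c3', c1', c2']
    generalize (x / q ^ m) ^ κ = Z
    generalize (-x ^ 2) ^ t = T at *
    generalize (-x) ^ m = T'
    field_simp
  linear_combination ((1 + x / q ^ m * q ^ κ) * (qPoch q q (2 * m) * (qqInv q κ * qqInv q t)) *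
    (qPoch x q (m + 1) * (qPoch (x ^ 2) q (κ + 1))⁻¹)) * key

end FiniteQuintuple


/-! ### Infinite products and the quintuple product identity. -/

section Analytic

open Filter Topology

theorem tendsto_qPoch (a : ℂ) {q : ℂ} (hq : ‖q‖ < 1) :
    Tendsto (qPoch a q) atTop (𝓝 (qPochInf a q)) := by
  have hs : Summable fun k : ℕ => ‖-(a * q ^ k)‖ := by
    simp only [norm_neg, norm_mul, norm_pow]
    exact (summable_geometric_of_lt_one (norm_nonneg q) hq).mul_left _
  have := (multipliable_one_add_of_summable hs).tendsto_prod_tprod_nat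
  simp only [← sub_eq_add_neg] at this
  exact this

theorem qPochInf_ne_zero {a q : ℂ} (hq : ‖q‖ < 1) (h : ∀ n, qPoch a q n ≠ 0) :
    qPochInf a q ≠ 0 := by
  have hs : Summable fun k : ℕ => ‖-(a * q ^ k)‖ := by
    simp only [norm_neg, norm_mul, norm_pow]
    exact (summable_geometric_of_lt_one (norm_nonneg q) hq).mul_left _
  have := tprod_one_add_ne_zero_of_summable (f := fun k : ℕ => -(a * q ^ k)) (fun k => by
    have := h (k + 1)
    rw [qPoch_succ] at this
    simpa [sub_eq_add_neg] using right_ne_zero_of_mul this) hs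
  simp only [← sub_eq_add_neg] at this
  exact this

theorem exists_norm_le_of_tendsto {f : ℕ → ℂ} {l : ℂ} (h : Tendsto f atTop (𝓝 l)) :
    ∃ C : ℝ, 0 ≤ C ∧ ∀ n, ‖f n‖ ≤ C := by
  obtain ⟨C, hC⟩ := (Metric.isBounded_range_of_tendsto f h).exists_norm_le
  have h1 : ∀ n, ‖f n‖ ≤ C := fun n => hC _ (Set.mem_range_self n)
  exact ⟨C, (norm_nonneg _).trans (h1 0), h1⟩

theorem pow_ne_one_of_norm_lt_one {q : ℂ} (hq : ‖q‖ < 1) (k : ℕ) (hk : 1 ≤ k) : q ^ k ≠ 1 := by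
  intro h
  have h1 : ‖q‖ ^ k < 1 := pow_lt_one₀ (norm_nonneg q) hq (by omega)
  rw [← norm_pow, h, norm_one] at h1
  exact lt_irrefl _ h1

theorem tendsto_toNat_add (c : ℤ) : Tendsto (fun m : ℕ => ((m : ℤ) + c).toNat) atTop atTop := by
  refine tendsto_atTop.2 fun b => ?_
  filter_upwards [eventually_ge_atTop (b + c.natAbs)] with m hm
  omega

theorem tendsto_qqInv {q : ℂ} (hq : ‖q‖ < 1) (c : ℤ) :
    Tendsto (fun m : ℕ => qqInv q ((m : ℤ) + c)) atTop (𝓝 (qPochInf q q)⁻¹) := by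
  have hne := qPochInf_ne_zero hq (qPoch_self_ne_zero (pow_ne_one_of_norm_lt_one hq))
  refine Tendsto.congr' ?_ (((tendsto_qPoch q hq).inv₀ hne).comp (tendsto_toNat_add c))
  filter_upwards [eventually_ge_atTop c.natAbs] with m hm
  rw [qqInv, if_pos (by omega), one_div, Function.comp_apply]

theorem exists_norm_qqInv_le {q : ℂ} (hq : ‖q‖ < 1) :
    ∃ C : ℝ, 0 ≤ C ∧ ∀ z : ℤ, ‖qqInv q z‖ ≤ C := by
  have hne := qPochInf_ne_zero hq (qPoch_self_ne_zero (pow_ne_one_of_norm_lt_one hq))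
  obtain ⟨C, hC, h⟩ := exists_norm_le_of_tendsto ((tendsto_qPoch q hq).inv₀ hne)
  refine ⟨C, hC, fun z => ?_⟩
  unfold qqInv
  split_ifs
  · rw [one_div]
    exact h _
  · simpa using hC

theorem qPochInf_split (a : ℂ) {q : ℂ} (hq : ‖q‖ < 1) :
    qPochInf a q = qPochInf a (q ^ 2) * qPochInf (a * q) (q ^ 2) := by
  have hq2 : ‖q ^ 2‖ < 1 := by
    rw [norm_pow]
    exact pow_lt_one₀ (norm_nonneg q) hq two_ne_zero
  have h1 : ∀ n, qPoch a q (2 * n) = qPoch a (q ^ 2) n * qPoch (a * q) (q ^ 2) n := by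
    intro n
    induction n with
    | zero => simp
    | succ n ih =>
      rw [show 2 * (n + 1) = 2 * n + 1 + 1 by ring, qPoch_succ, qPoch_succ, qPoch_succ, qPoch_succ,
        ih, ← pow_mul]
      ring
  have h2 : Tendsto (fun n : ℕ => 2 * n) atTop atTop :=
    tendsto_id.const_mul_atTop' two_pos
  refine tendsto_nhds_unique ((tendsto_qPoch a hq).comp h2) ?_
  refine Tendsto.congr (fun n => (h1 n).symm) ((tendsto_qPoch a hq2).mul (tendsto_qPoch _ hq2))

theorem qPochInf_sq (a : ℂ) {q : ℂ} (hq : ‖q‖ < 1) :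
    qPochInf (a ^ 2) (q ^ 2) = qPochInf a q * qPochInf (-a) q := by
  have hq2 : ‖q ^ 2‖ < 1 := by
    rw [norm_pow]
    exact pow_lt_one₀ (norm_nonneg q) hq two_ne_zero
  refine tendsto_nhds_unique (tendsto_qPoch (a ^ 2) hq2) ?_
  refine Tendsto.congr (fun n => ?_) ((tendsto_qPoch a hq).mul (tendsto_qPoch (-a) hq))
  rw [qPoch, qPoch, qPoch, ← Finset.prod_mul_distrib]
  refine Finset.prod_congr rfl fun k _ => ?_
  ring

theorem tsum_quintSymm {q x : ℂ} (hq : ‖q‖ < 1) (hq0 : q ≠ 0) (hx0 : x ≠ 0)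
    (hx : ∀ i : ℤ, x ^ 2 * q ^ i ≠ 1) (m : ℕ) : ∑' k : ℤ, quintSymm q x m k = 1 := by
  have hq1 := pow_ne_one_of_norm_lt_one hq
  have h1 : ∀ k : ℕ, (x / q ^ m) ^ 2 * q ^ k ≠ 1 := by
    intro k h
    refine hx ((k : ℤ) - (2 * m : ℕ)) ?_
    rw [← h, zpow_sub₀ hq0, zpow_natCast, zpow_natCast, div_pow, ← pow_mul, mul_comm 2 m]
    ring
  rw [← sum_quintTerm hq1 h1 (2 * m), tsum_eq_sum (s := Finset.Icc (-(m : ℤ)) m)]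
  · symm
    refine Finset.sum_bij (fun κ _ => (κ : ℤ) - m) ?_ ?_ ?_ ?_
    · intro k hk
      simp at hk ⊢
      omega
    · intro a _ b _ h
      simpa using h
    · intro j hj
      rw [Finset.mem_Icc] at hj
      exact ⟨(j + m).toNat, by simp; omega, by simp; omega⟩
    · intro κ hκ
      exact quintTerm_shift hq0 hx0 hx (by simp at hκ; omega)
  · intro k hk
    rw [Finset.mem_Icc, not_and_or, not_le, not_le] at hk
    rw [quintSymm]
    rcases hk with hk | hk
    · rw [qqInv_of_neg q (show (m : ℤ) + k < 0 by omega)]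
      simp
    · rw [qqInv_of_neg q (show (m : ℤ) - k < 0 by omega)]
      simp

/-- The quintuple product identity. -/
theorem quintuple_product {q x : ℂ} (hq : ‖q‖ < 1) (hq0 : q ≠ 0) (hx0 : x ≠ 0)
    (hx : ∀ i : ℤ, x ^ 2 * q ^ i ≠ 1)
    (hs : Summable fun k : ℤ => quintCoeff q x k * (1 + x * q ^ k)) :
    ∑' k : ℤ, quintCoeff q x k * (1 + x * q ^ k) = Q q x := by
  have hq1 := pow_ne_one_of_norm_lt_one hq
  have n0 := qPochInf_ne_zero hq (qPoch_self_ne_zero hq1)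
  have n1 : qPochInf (x ^ 2) q ≠ 0 := qPochInf_ne_zero hq fun n =>
    Finset.prod_ne_zero_iff.2 fun i _ h => hx i (by
      rw [zpow_natCast]
      linear_combination -h)
  have n2 : qPochInf (q / x ^ 2) q ≠ 0 := qPochInf_ne_zero hq fun n =>
    Finset.prod_ne_zero_iff.2 fun i _ h => hx (-(i + 1 : ℕ)) (by
      have h1 : q / x ^ 2 * q ^ i = 1 := by linear_combination -h
      rw [zpow_neg, zpow_natCast, pow_succ]
      field_simp at h1 ⊢
      linear_combination -h1)
  have t0 := tendsto_qPoch q hq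
  have t1 := (tendsto_qPoch (x ^ 2) hq).inv₀ n1
  have t2 := (tendsto_qPoch (q / x ^ 2) hq).inv₀ n2
  have t3 := tendsto_qPoch (q / x) hq
  have t4 := tendsto_qPoch x hq
  obtain ⟨C0, p0, b0⟩ := exists_norm_le_of_tendsto t0
  obtain ⟨C1, p1, b1⟩ := exists_norm_le_of_tendsto t1
  obtain ⟨C2, p2, b2⟩ := exists_norm_le_of_tendsto t2
  obtain ⟨C3, p3, b3⟩ := exists_norm_le_of_tendsto t3
  obtain ⟨C4, p4, b4⟩ := exists_norm_le_of_tendsto t4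
  obtain ⟨C5, p5, b5⟩ := exists_norm_qqInv_le hq
  have h2 : Tendsto (fun n : ℕ => 2 * n) atTop atTop :=
    tendsto_id.const_mul_atTop' two_pos
  have u (k : ℤ) : Tendsto (fun m : ℕ => qqInv q ((m : ℤ) - k)) atTop (𝓝 (qPochInf q q)⁻¹) := by
    simpa only [sub_eq_add_neg] using tendsto_qqInv hq (-k)
  -- All factors depending on `m` converge, hence are bounded uniformly in `m` and `k`; the summable
  -- series `hs` dominates.
  have lim := tendsto_tsum_of_dominated_convergence (f := fun m k => quintSymm q x m k)
    (g := fun k => quintCoeff q x k * (1 + x * q ^ k) *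
      (qPochInf q q * ((qPochInf q q)⁻¹ * (qPochInf q q)⁻¹) * (qPochInf (q / x) q * qPochInf x q) *
        ((qPochInf (q / x ^ 2) q)⁻¹ * (qPochInf (x ^ 2) q)⁻¹)))
    (bound := fun k => ‖quintCoeff q x k * (1 + x * q ^ k)‖ *
      (C0 * (C5 * C5) * (C3 * C4) * (C2 * C1))) (𝓕 := atTop)
    (hs.norm.mul_right _)
    (fun k => by
      refine Tendsto.const_mul _ ((((t0.comp h2).mul ((tendsto_qqInv hq k).mul (u k))).mul
        (t3.mul (t4.comp (tendsto_add_atTop_nat 1)))).mul (Tendsto.mul ?_ ?_))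
      · simpa only [sub_eq_add_neg, Function.comp_def] using t2.comp (tendsto_toNat_add (-k))
      · simpa only [add_assoc, Function.comp_def] using t1.comp (tendsto_toNat_add (k + 1)))
    (Eventually.of_forall fun m k => by
      rw [quintSymm, norm_mul]
      refine mul_le_mul_of_nonneg_left ?_ (norm_nonneg _)
      simp only [norm_mul]
      gcongr
      · exact b0 _
      · exact b5 _
      · exact b5 _
      · exact b3 _
      · exact b4 _
      · exact b2 _
      · exact b1 _)
  simp only [tsum_quintSymm hq hq0 hx0 hx, tsum_mul_right] at lim
  have e := tendsto_nhds_unique lim tendsto_const_nhds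
  -- Splitting into base `q^2` exposes `(x)_∞ (-x)_∞` in `(x^2)_∞` and `(q/x)_∞ (-q/x)_∞` in
  -- `(q/x^2)_∞`; the factors without sign cancel.
  have s1 := qPochInf_split (x ^ 2) hq
  have s2 := qPochInf_split (q / x ^ 2) hq
  rw [qPochInf_sq x hq] at s1
  rw [show q / x ^ 2 * q = (q / x) ^ 2 by ring, qPochInf_sq (q / x) hq] at s2
  rw [s1] at n1
  rw [s2] at n2
  rw [s1, s2] at e
  have m1 := left_ne_zero_of_mul (left_ne_zero_of_mul n1)
  have m2 := right_ne_zero_of_mul (left_ne_zero_of_mul n1)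
  have m3 := right_ne_zero_of_mul n1
  have m4 := left_ne_zero_of_mul n2
  have m5 := left_ne_zero_of_mul (right_ne_zero_of_mul n2)
  have m6 := right_ne_zero_of_mul (right_ne_zero_of_mul n2)
  rw [Q]
  field_simp at e
  linear_combination e

end Analytic


/-! ### The limit `L → ∞`. -/

section Limit

open Filter Topology

/-- A linear lower bound on the quadratic exponent is enough to dominate the theta series by a
geometric one. -/
theorem natAbs_le_expo_add (w : ℕ) (j : ℤ) : j.natAbs ≤ expo w j + 3 := by
  have h1 := two_mul_expo w j
  have h2 : 0 ≤ 2 * (w : ℤ) * (j * (j - 1)) := mul_nonneg (by positivity) (mul_pred_nonneg j)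
  have h3 : (j.natAbs : ℤ) ≤ expo w j + 3 := by
    rw [Int.natCast_natAbs, abs_le]
    constructor <;> nlinarith [sq_nonneg (2 * j - 5), sq_nonneg (2 * j - 1)]
  exact_mod_cast h3

theorem summable_pow_natAbs {r : ℝ} (h0 : 0 ≤ r) (h1 : r < 1) :
    Summable fun j : ℤ => r ^ j.natAbs := by
  rw [summable_int_iff_summable_nat_and_neg]
  simpa using summable_geometric_of_lt_one h0 h1

theorem summable_pow_expo {r : ℝ} (h0 : 0 < r) (h1 : r < 1) (w : ℕ) :
    Summable fun j : ℤ => r ^ expo w j := by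
  refine Summable.of_nonneg_of_le (fun j => by positivity) (fun j => ?_)
    ((summable_pow_natAbs h0.le h1).mul_left (r ^ 3)⁻¹)
  rw [le_inv_mul_iff₀ (by positivity), ← pow_add, add_comm]
  exact pow_le_pow_of_le_one h0.le h1.le (natAbs_le_expo_add w j)

theorem norm_legendreSym_le (j : ℤ) : ‖((legendreSym 3 j : ℤ) : ℂ)‖ ≤ 1 := by
  by_cases h : (j : ZMod 3) = 0
  · rw [(legendreSym.eq_zero_iff 3 j).2 h]
    simp
  · rcases legendreSym.eq_one_or_neg_one 3 h with h | h <;> simp [h]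

theorem norm_theta_term_le (q : ℂ) (w : ℕ) (j : ℤ) :
    ‖((legendreSym 3 j : ℤ) : ℂ) * q ^ expo w j‖ ≤ ‖q‖ ^ expo w j := by
  rw [norm_mul, norm_pow]
  exact mul_le_of_le_one_left (by positivity) (norm_legendreSym_le j)

theorem summable_theta {q : ℂ} (hq : ‖q‖ < 1) (hq0 : q ≠ 0) (w : ℕ) :
    Summable fun j : ℤ => ((legendreSym 3 j : ℤ) : ℂ) * q ^ expo w j :=
  Summable.of_norm_bounded (summable_pow_expo (norm_pos_iff.2 hq0) hq w) (norm_theta_term_le q w)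

theorem tendsto_thetaSum {q : ℂ} (hq : ‖q‖ < 1) (hq0 : q ≠ 0) (w : ℕ) :
    Tendsto (thetaSum q w) atTop (𝓝 ((∑' j : ℤ, ((legendreSym 3 j : ℤ) : ℂ) * q ^ expo w j) *
      ((qPochInf q q)⁻¹ * (qPochInf q q)⁻¹))) := by
  obtain ⟨C, hC, b⟩ := exists_norm_qqInv_le hq
  have lim := tendsto_tsum_of_dominated_convergence (𝓕 := atTop)
    (f := fun (L : ℕ) (j : ℤ) => ((legendreSym 3 j : ℤ) : ℂ) * q ^ expo w j *
      (qqInv q ((L : ℤ) + j) * qqInv q ((L : ℤ) + 1 - j)))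
    (g := fun j => ((legendreSym 3 j : ℤ) : ℂ) * q ^ expo w j *
      ((qPochInf q q)⁻¹ * (qPochInf q q)⁻¹))
    (bound := fun j => ‖q‖ ^ expo w j * (C * C))
    ((summable_pow_expo (norm_pos_iff.2 hq0) hq w).mul_right _)
    (fun j => by
      refine Tendsto.const_mul _ ((tendsto_qqInv hq j).mul ?_)
      simpa only [add_sub_assoc] using tendsto_qqInv hq (1 - j))
    (Eventually.of_forall fun L j => by
      rw [norm_mul, norm_mul (qqInv _ _)]
      have := norm_theta_term_le q w j
      gcongr
      · exact b _
      · exact b _)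
  rw [tsum_mul_right] at lim
  refine lim.congr fun L => ?_
  rw [thetaSum]
  refine tsum_eq_sum fun j hj => ?_
  rw [Finset.mem_Icc, not_and_or, not_le, not_le] at hj
  rcases hj with hj | hj
  · rw [qqInv_of_neg q (show (L : ℤ) + j < 0 by omega), zero_mul, mul_zero]
  · rw [qqInv_of_neg q (show (L : ℤ) + 1 - j < 0 by omega), mul_zero, mul_zero]

/-- Multiples of 3 drop out. The terms at `3k+1` and `3k+2` have opposite signs and exponents
differing by `2v + (6v+3)k`, so together they form the `k`-th quintuple term. -/
theorem tsum_theta_eq_quintuple {q : ℂ} (hq : ‖q‖ < 1) (hq0 : q ≠ 0) {v : ℕ} (hv : 1 ≤ v) :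
    ∑' j : ℤ, ((legendreSym 3 j : ℤ) : ℂ) * q ^ expo v j = Q (q ^ (6 * v + 3)) (-q ^ (2 * v)) := by
  have hs := summable_theta hq hq0 v
  have term : ∀ k : ℤ, ((legendreSym 3 (k * 3 + 1) : ℤ) : ℂ) * q ^ expo v (k * 3 + 1) +
      ((legendreSym 3 (k * 3 + 2) : ℤ) : ℂ) * q ^ expo v (k * 3 + 2) =
      quintCoeff (q ^ (6 * v + 3)) (-q ^ (2 * v)) k *
        (1 + -q ^ (2 * v) * (q ^ (6 * v + 3)) ^ k) := by
    intro k
    have e1 : legendreSym 3 (k * 3 + 1) = 1 := by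
      rw [legendreSym.mod, show (k * 3 + 1) % ((3 : ℕ) : ℤ) = 1 by omega]
      decide
    have e2 : legendreSym 3 (k * 3 + 2) = -1 := by
      rw [legendreSym.mod, show (k * 3 + 2) % ((3 : ℕ) : ℤ) = 2 by omega]
      decide
    have x1 := two_mul_expo v (k * 3 + 1)
    have x2 := two_mul_expo v (k * 3 + 2)
    have x3 := quint_exponent k
    have hc : quintCoeff (q ^ (6 * v + 3)) (-q ^ (2 * v)) k = q ^ expo v (k * 3 + 1) := by
      have hsign : (-1 : ℂ) ^ k * (-1) ^ (3 * k) = 1 := by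
        rw [← zpow_add₀ (by norm_num), show k + 3 * k = 2 * (2 * k) by ring, zpow_mul]
        norm_num
      rw [quintCoeff, neg_eq_neg_one_mul (q ^ (2 * v)), mul_zpow, ← mul_assoc, hsign, one_mul,
        ← zpow_natCast, ← zpow_natCast, ← zpow_natCast, ← zpow_mul, ← zpow_mul, ← zpow_add₀ hq0]
      congr 1
      refine mul_left_cancel₀ (two_ne_zero (α := ℤ)) ?_
      push_cast
      linear_combination (6 * (v : ℤ) + 3) * x3 - x1
    have hd : q ^ expo v (k * 3 + 2) =
        q ^ expo v (k * 3 + 1) * (q ^ (2 * v) * (q ^ (6 * v + 3)) ^ k) := by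
      rw [← zpow_natCast, ← zpow_natCast, ← zpow_natCast, ← zpow_natCast, ← zpow_mul,
        ← zpow_add₀ hq0, ← zpow_add₀ hq0]
      congr 1
      refine mul_left_cancel₀ (two_ne_zero (α := ℤ)) ?_
      push_cast
      linear_combination x2 - x1
    rw [e1, e2, hd, hc]
    push_cast
    ring
  have z : ∀ k : ℤ, legendreSym 3 (k * 3) = 0 := by
    intro k
    rw [legendreSym.mod, show (k * 3) % ((3 : ℕ) : ℤ) = 0 by omega]
    decide
  let e := (Int.divModEquiv 3).symm
  have he : ∀ p : ℤ × Fin 3, e p = p.1 * 3 + p.2 := fun p => by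
    simp [e, Int.divModEquiv]
  have hs' := (e.summable_iff (f := fun j : ℤ => ((legendreSym 3 j : ℤ) : ℂ) * q ^ expo v j)).2 hs
  have inner : ∀ k : ℤ, ∑' i : Fin 3, ((fun j : ℤ => ((legendreSym 3 j : ℤ) : ℂ) *
      q ^ expo v j) ∘ e) (k, i) = quintCoeff (q ^ (6 * v + 3)) (-q ^ (2 * v)) k *
        (1 + -q ^ (2 * v) * (q ^ (6 * v + 3)) ^ k) := by
    intro k
    rw [tsum_fintype, Fin.sum_univ_three, ← term]
    simp [he, z]
  have hsum := hs'.prod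
  simp only [inner] at hsum
  rw [← e.tsum_eq, ← quintuple_product ?_ (pow_ne_zero _ hq0)
    (neg_ne_zero.2 (pow_ne_zero _ hq0)) ?_ hsum]
  · rw [← tsum_congr inner]
    exact hs'.tsum_prod
  · rw [norm_pow]
    exact pow_lt_one₀ (norm_nonneg q) hq (by omega)
  · intro i h
    have h1 : q ^ (4 * (v : ℤ) + (6 * v + 3) * i) = 1 := by
      rw [← h, zpow_add₀ hq0, show 4 * (v : ℤ) = (2 * v * 2 : ℕ) by push_cast; ring,
        show 6 * (v : ℤ) + 3 = (6 * v + 3 : ℕ) by push_cast; ring, zpow_mul, zpow_natCast,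
        zpow_natCast, pow_mul q (2 * v), neg_sq]
    have h2 := congrArg norm h1
    rw [norm_zpow, norm_one] at h2
    have h3 := (zpow_eq_one_iff_right₀ (norm_nonneg q) hq.ne).1 h2
    -- The exponent `4v + (6v+3)i` is positive for `i ≥ 0` and negative for `i ≤ -1`, so it is never
    -- zero.
    rcases le_or_gt 0 i with hi | hi
    · nlinarith
    · nlinarith

theorem exists_norm_summand_le {q : ℂ} (hq : ‖q‖ < 1) (v : ℕ) (hv : 1 ≤ v) :
    ∃ C : ℝ, 0 ≤ C ∧ ∀ n : Fin v → ℕ, ‖summand hv q n‖ ≤ C * ∏ i, ‖q‖ ^ n i := by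
  have hq1 := pow_ne_one_of_norm_lt_one hq
  have hq3 : ‖q ^ 3‖ < 1 := by
    rw [norm_pow]
    exact pow_lt_one₀ (norm_nonneg q) hq (by omega)
  obtain ⟨C, hC, b⟩ := exists_norm_qqInv_le hq
  obtain ⟨C1, hC1, b1⟩ := exists_norm_le_of_tendsto (tendsto_qPoch (-1) hq3)
  obtain ⟨C2, hC2, b2⟩ := exists_norm_le_of_tendsto
    ((tendsto_qPoch (-1) hq).inv₀ (qPochInf_ne_zero hq (qPoch_neg_one_ne_zero hq1)))
  have hle : ∀ k, ‖q ^ k‖ ≤ 1 := fun k => by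
    rw [norm_pow]
    exact pow_le_one₀ (norm_nonneg q) hq.le
  induction v, hv using Nat.le_induction with
  | base =>
    refine ⟨1 * (C1 * C2) * C * 3, by positivity, fun n => ?_⟩
    rw [summand_one, norm_mul, mul_comm, Fin.prod_univ_one, div_eq_mul_inv]
    have h3 : ‖1 + q - q ^ (1 + n 0)‖ ≤ 3 := by
      refine (norm_sub_le _ _).trans ?_
      have h4 := norm_add_le 1 q
      rw [norm_one] at h4
      linarith [hle (1 + n 0)]
    have h5 : ‖q ^ (n 0 * (n 0 + 1))‖ ≤ ‖q‖ ^ n 0 := by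
      rw [norm_pow]
      exact pow_le_pow_of_le_one (norm_nonneg q) hq.le (Nat.le_mul_of_pos_right _ (by omega))
    simp only [norm_mul (_ * _ : ℂ), norm_mul (q ^ n 0), norm_mul (qPoch _ _ _)]
    gcongr
    · exact hle _
    · exact b1 _
    · exact b2 _
    · exact b _
  | succ v hv ih =>
    obtain ⟨D, hD, bD⟩ := ih
    refine ⟨C * D, by positivity, fun n => ?_⟩
    obtain ⟨a, n, rfl⟩ : ∃ (a : ℕ) (m : Fin v → ℕ), n = (Fin.cons a m : Fin (v + 1) → ℕ) :=
      ⟨n 0, Fin.tail n, (Fin.cons_self_tail n).symm⟩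
    have h5 : ‖q ^ ((a + N n ⟨0, hv⟩) * (a + N n ⟨0, hv⟩ + 1))‖ ≤ ‖q‖ ^ a := by
      rw [norm_pow]
      exact pow_le_pow_of_le_one (norm_nonneg q) hq.le
        ((Nat.le_add_right _ _).trans (Nat.le_mul_of_pos_right _ (by omega)))
    rw [summand_cons hv, norm_mul, norm_mul, Fin.prod_univ_succ]
    simp only [Fin.cons_zero, Fin.cons_succ]
    calc _ ≤ ‖q‖ ^ a * C * (D * ∏ i, ‖q‖ ^ n i) := by
          gcongr
          · exact b _
          · exact bD n
      _ = _ := by ring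

theorem summable_prod_pow {r : ℝ} (h0 : 0 ≤ r) (h1 : r < 1) (v : ℕ) :
    Summable fun n : Fin v → ℕ => ∏ i, r ^ n i := by
  induction v with
  | zero => exact Summable.of_finite
  | succ v ih =>
    rw [← (Fin.consEquiv fun _ : Fin (v + 1) => ℕ).summable_iff]
    have h := (summable_geometric_of_lt_one h0 h1).mul_of_nonneg ih (fun _ => by positivity)
      (fun _ => Finset.prod_nonneg fun _ _ => by positivity)
    refine h.congr fun p => ?_
    simp [Fin.consEquiv, Fin.prod_univ_succ]

theorem summable_norm_summand {q : ℂ} (hq : ‖q‖ < 1) (v : ℕ) (hv : 1 ≤ v) :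
    Summable fun n : Fin v → ℕ => ‖summand hv q n‖ := by
  obtain ⟨C, _, b⟩ := exists_norm_summand_le hq v hv
  exact Summable.of_nonneg_of_le (fun _ => norm_nonneg _) b
    ((summable_prod_pow (norm_nonneg q) hq v).mul_left C)

/-- Only `n = 0` contributes, with value 1. On the product side `0 / 0 = 0` makes every infinite
product equal to 1, in agreement with the limit `q → 0`. -/
theorem hasSum_summand_zero (v : ℕ) (hv : 1 ≤ v) :
    HasSum (fun n : Fin v → ℕ => summand hv (0 : ℂ) n)
      (Q (0 ^ (6 * v + 3)) (-0 ^ (2 * v)) / qPochInf 0 0) := by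
  have h1 : ∀ a : ℂ, qPochInf 0 a = 1 := fun a => by simp [qPochInf]
  have h2 : Q (0 ^ (6 * v + 3)) (-0 ^ (2 * v)) / qPochInf 0 0 = summand hv (0 : ℂ) 0 := by
    have hN : ∀ i, N (0 : Fin v → ℕ) i = 0 := fun i => by simp [N]
    rw [zero_pow (by omega), zero_pow (by omega), Q]
    simp [h1, summand, hN, qPoch]
  rw [h2]
  refine hasSum_single 0 fun n hn => ?_
  obtain ⟨i, hi⟩ := Function.ne_iff.1 hn
  have h3 : ∑ i, N n i * (N n i + 1) ≠ 0 := by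
    have h4 : 1 ≤ N n ⟨0, hv⟩ := (Nat.one_le_iff_ne_zero.2 hi).trans (le_N_zero hv n i)
    have h5 := Finset.single_le_sum (f := fun i => N n i * (N n i + 1)) (fun _ _ => Nat.zero_le _)
      (Finset.mem_univ ⟨0, hv⟩)
    have : 0 < N n ⟨0, hv⟩ * (N n ⟨0, hv⟩ + 1) := by positivity
    exact (this.trans_le h5).ne'
  simp [summand, pow_add, zero_pow h3]

theorem hasSum_summand {q : ℂ} (hq : ‖q‖ < 1) (v : ℕ) (hv : 1 ≤ v) :
    HasSum (fun n : Fin v → ℕ => summand hv q n)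
      (Q (q ^ (6 * v + 3)) (-q ^ (2 * v)) / qPochInf q q) := by
  rcases eq_or_ne q 0 with rfl | hq0
  · exact hasSum_summand_zero v hv
  have hq1 := pow_ne_one_of_norm_lt_one hq
  have hne := qPochInf_ne_zero hq (qPoch_self_ne_zero hq1)
  have hs := summable_norm_summand hq v hv
  obtain ⟨C, hC, b⟩ := exists_norm_qqInv_le hq
  have lim := tendsto_tsum_of_dominated_convergence (𝓕 := atTop)
    (f := fun (L : ℕ) (n : Fin v → ℕ) => summand hv q n * qqInv q ((L : ℤ) - N n ⟨0, hv⟩))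
    (g := fun n => summand hv q n * (qPochInf q q)⁻¹)
    (bound := fun n => ‖summand hv q n‖ * C)
    (hs.mul_right _)
    (fun n => by
      refine Tendsto.const_mul _ ?_
      simpa only [sub_eq_add_neg] using tendsto_qqInv hq (-(N n ⟨0, hv⟩ : ℤ)))
    (Eventually.of_forall fun L n => by
      rw [norm_mul]
      gcongr
      exact b _)
  have h1 : ∀ L : ℕ, ∑' n : Fin v → ℕ, summand hv q n * qqInv q ((L : ℤ) - N n ⟨0, hv⟩) =
      thetaSum q v L := by
    intro L
    rw [← multisum_eq_thetaSum hq1 v hv le_rfl]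
    exact tsum_eq_sum fun n hn => mul_qqInv_eq_zero hv q _ L n hn
  simp only [h1, tsum_mul_right] at lim
  -- The multisum side carries one factor `1/(q)_∞` in the limit and the theta side two; one of them
  -- cancels.
  have e := tendsto_nhds_unique lim (tendsto_thetaSum hq hq0 v)
  rw [tsum_theta_eq_quintuple hq hq0 hv, ← mul_assoc] at e
  have e' := mul_right_cancel₀ (inv_ne_zero hne) e
  rw [div_eq_mul_inv, ← e']
  exact hs.of_norm.hasSum

end Limit

end BaileyHierarchy
theorem mainTheorem8 (v : ℕ) (hv : 1 ≤ v) :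
    -- the finite version, for every bound `L`
    (∀ (K : Type*) [Field K] [CharZero K] (q : K), (∀ k : ℕ, 1 ≤ k → q ^ k ≠ 1) → ∀ L : ℕ,
      ∑ᶠ n : Fin v → ℕ, BaileyHierarchy.summand hv q n *
          (BaileyHierarchy.qPoch q q (2 * L + 1) *
            BaileyHierarchy.qqInv q ((L : ℤ) - (BaileyHierarchy.N n ⟨0, hv⟩ : ℤ))) =
        ∑ᶠ j : ℤ, ((legendreSym 3 j : ℤ) : K) *
          q ^ (((2 * (v : ℤ) + 1) * j ^ 2 - (2 * (v : ℤ) + 3) * j) / 2 + 1) *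
          BaileyHierarchy.qBinom q (2 * (L : ℤ) + 1) ((L : ℤ) + j)) ∧
    -- the limiting identity
    (∀ q : ℂ, ‖q‖ < 1 →
      HasSum (fun n : Fin v → ℕ => BaileyHierarchy.summand hv q n)
        (BaileyHierarchy.Q (q ^ (6 * v + 3)) (-q ^ (2 * v)) /
          BaileyHierarchy.qPochInf q q)) :=
  ⟨fun _ _ _ _ hq L => BaileyHierarchy.finite_identity hq v hv L,
    fun _ hq => BaileyHierarchy.hasSum_summand hq v hv⟩
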